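/- Let $S=S^1\times[0,1]$ be the annulus, realised as $\{z\in\mathbb{C}: 1\le |z|\le 2\}$ via $(u,t)\mapsto(1+t)u$ and oriented as a subset of the plane. A \emph{foliation} on $S$ is a section $\eta$ of the projectivized tangent bundle $\mathbb{P}(TS)$; foliations are considered up to homotopy of sections. A \emph{marking} of $S$ is a subset $M\subset\partial S$ which on each of the two boundary circles is either the whole circle or a union of $n\ge 1$ disjoint open intervals separated by non-degenerate unmarked intervals. An \emph{arc} in $(S,M)$ is a smoothly embedded closed interval which meets $\partial S$ exactly in its endpoints, transversely and in $M$, and is not isotopic to an interval in $M$. A \emph{boundary path} from an arc $X$ to an arc $Y$ is a non-constant path in $M$ from an endpoint of $X$ to an endpoint of $Y$ which follows the reversed boundary orientation. A \emph{grading} of an immersed curve $\gamma$ is a continuous choice of homotopy classes of paths $\tilde\gamma$ in the fibres of $\mathbb{P}(TS)$ from the tangent line of $\gamma$ to $\eta$. For graded curves meeting transversely at $p$, the index $i_p(\gamma_1,\gamma_2)\in\pi_1(\mathbb{P}(T_pS),\eta_p)\cong\mathbb{Z}$ is the class of the loop which runs from $\eta_p$ backwards along $\tilde\gamma_1(p)$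 to $\dot\gamma_1$, then along the shortest counterclockwise path to $\dot\gamma_2$, then along $\tilde\gamma_2(p)$ to $\eta_p$. The \emph{degree} of a boundary path $\gamma$ from $X$ to $Y$ is $|\gamma|=i_{\gamma(0)}(X,\gamma)-i_{\gamma(1)}(Y,\gamma)$. A \emph{double pair} consists of two disjoint arcs $X,Y$ and two distinct boundary paths $\gamma,\gamma'$ from $X$ to $Y$ which start at the same end of $X$ if and only if they finish at the same end of $Y$ (this condition is automatic if $M=\partial S$). The foliation $\eta$ is \emph{balanced} for $M$ if $|\gamma|=|\gamma'|$ for every double pair and all gradings of $X$ and $Y$. Then there is exactly one balanced foliation on the annulus up to homotopy. More precisely, there is a homotopy class $c$ of foliations such that for every foliation $\eta$: (1) for every marking $M$ of $S$, $\eta$ is balanced for $M$ if and only if $\eta\in c$; (2) the winding number $\eta\ast\gamma$ of the tangent line of $\gamma$ relative to $\eta$ vanishes for all smooth embedded closed curves $\gamma$ in $S$ that are not null-homotopic if and only if $\eta\in c$; (3) the map $S^1\to S^1$ obtained by restricting $\eta$ to $S^1\times\{0\}$ under the rotation-invariant trivialization $\mathbb{P}(TS)\cong S\times\mathbb{P}(\mathbb{R}^2)\cong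 S\times S^1$ has degree $0$ if and only if $\eta\in c$. -/

import Mathlib

open Set Topology
open scoped ContDiff LinearAlgebra.Projectivization

noncomputable section

namespace AnnulusFoliation

/-! ### The annulus and its foliations -/

/-- The annulus `S = S¹ × [0,1]`, realised as the planar domain `1 ≤ ‖z‖ ≤ 2` through
`(u, t) ↦ (1 + t) u`. It carries the orientation of the plane, and its tangent space at every
point (boundary points included) is `ℂ`. -/
def annulus : Set ℂ := {z | 1 ≤ ‖z‖ ∧ ‖z‖ ≤ 2}

/-- The real projective line of lines in `ℂ = ℝ²`, with the quotient topology of `ℂ \ {0}`. -/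
instance lineTopology : TopologicalSpace (ℙ ℝ ℂ) :=
  inferInstanceAs (TopologicalSpace (Quotient (projectivizationSetoid ℝ ℂ)))

/-- A foliation (line field): a section of `P(TS)`. As `T_z S = ℂ` for a planar domain, the fibre
of `P(TS)` over every `z` is `ℙ ℝ ℂ`. -/
abbrev Foliation : Type := C(annulus, ℙ ℝ ℂ)

/-- The set `π₀ Γ(S, P(TS))` of homotopy classes of foliations. -/
def FoliationClass : Type :=
  Quotient (⟨ContinuousMap.Homotopic, ContinuousMap.Homotopic.equivalence⟩ : Setoid Foliation)

/-- The homotopy class of a foliation. -/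
def Foliation.toClass (η : Foliation) : FoliationClass := Quotient.mk _ η

/-! ### The trivialization `P(TS) ≅ S × S¹` and the degree -/

/-- The homeomorphism `P(ℝ²) ≅ S¹`, `[v] ↦ v² / ‖v‖² = v / conj v`. -/
def lineToCircle : ℙ ℝ ℂ → Circle :=
  Projectivization.lift (fun v => (Circle.ofConjDivSelf v.1 v.2)⁻¹) (by
    rintro ⟨a, ha⟩ ⟨b, hb⟩ t h
    have ht : t ≠ 0 := by
      rintro rfl
      exact ha (by simpa using h)
    have ht' : (t : ℂ) ≠ 0 := by exact_mod_cast ht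
    have hab : a = (t : ℂ) * b := by simpa using h
    subst hab
    congr 1
    ext
    simp only [Circle.ofConjDivSelf, map_mul, Complex.conj_ofReal]
    exact mul_div_mul_left _ _ ht')

/-- The rotation-invariant trivialization of the tangent spaces of the annulus at a point `z ≠ 0`:
the tangent vector `v` has the coordinate `v / (i z)`, so the tangent vector `i z` of the circle
direction has the coordinate `1`, and the inward radial vector `- z` the coordinate `i`. -/
def frameCoord (z : ℂ) : ℂ →ₗ[ℝ] ℂ := LinearMap.mulLeft ℝ (Complex.I * z)⁻¹

lemma frameCoord_injective {z : ℂ} (hz : z ≠ 0) : Function.Injective (frameCoord z) := by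
  have h : (Complex.I * z)⁻¹ ≠ 0 := inv_ne_zero (mul_ne_zero Complex.I_ne_zero hz)
  exact fun a b hab => mul_left_cancel₀ h hab

lemma ne_zero_of_mem_annulus {z : ℂ} (hz : z ∈ annulus) : z ≠ 0 := by
  rintro rfl
  have := hz.1
  norm_num at this

/-- The trivialization `P(TS) ≅ S × P(ℝ²) ≅ S × S¹` induced by the frame. -/
def trivialization (p : annulus × ℙ ℝ ℂ) : annulus × Circle :=
  (p.1, lineToCircle (Projectivization.map (frameCoord p.1)
    (frameCoord_injective (ne_zero_of_mem_annulus p.1.2)) p.2))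

/-- The inclusion of `S¹` as `S¹ × {0}` in the annulus. -/
def innerCircle (u : Circle) : annulus :=
  ⟨(u : ℂ), by constructor <;> rw [Circle.norm_coe]; norm_num⟩

/-- The self-map of the circle that corresponds to a foliation: the foliation is a map `S → S¹`
under the trivialization, and `S` is homotopy equivalent to `S¹ × {0}`. -/
def Foliation.circleMap (η : Foliation) (u : Circle) : Circle :=
  (trivialization (innerCircle u, η (innerCircle u))).2

/-- A self-map of the circle has degree `d`: it has a continuous lift `F` to the universal cover
with `F (t + 2π) = F t + 2π d`. -/
def HasDegree (f : Circle → Circle) (d : ℤ) : Prop :=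
  ∃ F : ℝ → ℝ, Continuous F ∧ (∀ t, f (Circle.exp t) = Circle.exp (F t)) ∧
    ∀ t, F (t + 2 * Real.pi) = F t + d * (2 * Real.pi)

/-! ### Curves, gradings and intersection indices -/

/-- The velocity of a curve parametrized by `[0,1]`. -/
def velocity (γ : ℝ → ℂ) (t : ℝ) : ℂ := derivWithin γ (Icc 0 1) t

/-- A smooth immersed curve `[0,1] → S`. Values of `γ` outside `[0,1]` are irrelevant. -/
structure IsImmersedCurve (γ : ℝ → ℂ) : Prop where
  smooth : ContDiffOn ℝ ∞ γ (Icc 0 1)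
  mem : ∀ t ∈ Icc (0 : ℝ) 1, γ t ∈ annulus
  immersed : ∀ t ∈ Icc (0 : ℝ) 1, velocity γ t ≠ 0

/-- A grading of an immersed curve: a continuous choice of (homotopy classes of) paths in
`P(T_{γ t} S)` from the tangent line of `γ` to the line of `η`. The homotopy class of such a path
is given by its total counterclockwise angle `a t`. -/
def IsGrading (η : Foliation) (γ : ℝ → ℂ) (a : ℝ → ℝ) : Prop :=
  ContinuousOn a (Icc 0 1) ∧ ∀ t ∈ Icc (0 : ℝ) 1, ∀ h : γ t ∈ annulus,
    Complex.exp (a t * Complex.I) * velocity γ t ∈ (η ⟨γ t, h⟩).submodule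

/-- The angle in `[0, π)` of the shortest counterclockwise rotation taking the line `ℝ v` to the
line `ℝ w`; it lies in `(0, π)` if the lines are distinct. -/
def ccwAngle (v w : ℂ) : ℝ := toIcoMod Real.pi_pos 0 (Complex.arg (w / v))

/-- The intersection index of two graded curves that meet transversely at a point, with velocities
`v₁, v₂` and gradings `a₁, a₂` there. The loop in `P(T_p S)` based at `η_p` goes to the first line
(angle `- a₁`), from there counterclockwise to the second line, and back to `η_p` (angle `a₂`);
its class in `π₁ ≅ ℤ` is its total angle divided by `π`, always an integer. -/
def intersectionIndex (v₁ v₂ : ℂ) (a₁ a₂ : ℝ) : ℝ := (-a₁ + ccwAngle v₁ v₂ + a₂) / Real.pi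

/-! ### Markings, arcs and boundary paths -/

/-- A marking of the circle of radius `r`: the whole circle if it has no corners, and otherwise
`n ≥ 1` disjoint open intervals separated by non-degenerate unmarked intervals; the corners are
the endpoints of these intervals. -/
def IsCircleMarking (r : ℝ) (M : Set ℂ) : Prop :=
  M = {z | ‖z‖ = r} ∨
  ∃ (n : ℕ) (a b : Fin n → ℝ), 0 < n ∧ (∀ i, a i < b i) ∧ (∀ i j, i < j → b i < a j) ∧
    (∀ i j, b i < a j + 2 * Real.pi) ∧
    M = {z | ∃ i, ∃ θ ∈ Ioo (a i) (b i), z = r * Complex.exp (θ * Complex.I)}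

/-- A marking of the annulus. -/
def IsMarking (M : Set ℂ) : Prop :=
  ∃ M₁ M₂ : Set ℂ, IsCircleMarking 1 M₁ ∧ IsCircleMarking 2 M₂ ∧ M = M₁ ∪ M₂

/-- A curve with endpoints in `M` can be deformed into `M`, the endpoints staying in `M`. For
embedded curves this is the same as being isotopic to an interval in `M`. -/
def DeformsInto (M : Set ℂ) (X : ℝ → ℂ) : Prop :=
  ∃ H : ℝ × ℝ → ℂ, ContinuousOn H (Icc 0 1 ×ˢ Icc 0 1) ∧
    (∀ s ∈ Icc (0 : ℝ) 1, ∀ t ∈ Icc (0 : ℝ) 1, H (s, t) ∈ annulus) ∧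
    (∀ t ∈ Icc (0 : ℝ) 1, H (0, t) = X t) ∧
    (∀ s ∈ Icc (0 : ℝ) 1, H (s, 0) ∈ M ∧ H (s, 1) ∈ M) ∧
    (∀ t ∈ Icc (0 : ℝ) 1, H (1, t) ∈ M)

/-- An arc in the marked annulus: an embedded closed interval that meets the boundary exactly at
its endpoints, transversely and in `M`, and that is not isotopic to an interval in `M`. The
boundary has the tangent vector `i z` at `z`. -/
structure IsArc (M : Set ℂ) (X : ℝ → ℂ) : Prop extends IsImmersedCurve X where
  injOn : InjOn X (Icc 0 1)
  interior : ∀ t ∈ Ioo (0 : ℝ) 1, 1 < ‖X t‖ ∧ ‖X t‖ < 2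
  endpoints : X 0 ∈ M ∧ X 1 ∈ M
  transverse : ∀ t, t = 0 ∨ t = 1 → ∀ c : ℝ, velocity X t ≠ c * (Complex.I * X t)
  essential : ¬ DeformsInto M X

/-- The direction of the reversed boundary orientation at a boundary point: the surface lies to
its right. It is counterclockwise on the inner circle and clockwise on the outer circle. -/
def reverseBoundary (z : ℂ) : ℂ := if ‖z‖ = 1 then Complex.I * z else -(Complex.I * z)

/-- A non-trivial boundary path from `X` to `Y`: a path in `M` along the reversed boundary
orientation from the endpoint `X s` of `X` to the endpoint `Y t` of `Y`, where `s, t ∈ {0, 1}`. -/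
structure IsBoundaryPath (M : Set ℂ) (X Y : ℝ → ℂ) (γ : ℝ → ℂ) (s t : ℝ) : Prop
    extends IsImmersedCurve γ where
  mem_marking : ∀ u ∈ Icc (0 : ℝ) 1, γ u ∈ M
  direction : ∀ u ∈ Icc (0 : ℝ) 1, ∃ c : ℝ, 0 < c ∧ velocity γ u = c * reverseBoundary (γ u)
  source : s = 0 ∨ s = 1
  target : t = 0 ∨ t = 1
  start : γ 0 = X s
  finish : γ 1 = Y t

/-- The degree `i_{γ(0)}(X, γ) - i_{γ(1)}(Y, γ)` of a boundary path from `X s` to `Y t`, for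
gradings `x, y, g` of `X, Y, γ`. -/
def pathDegree (X Y γ : ℝ → ℂ) (s t : ℝ) (x y g : ℝ → ℝ) : ℝ :=
  intersectionIndex (velocity X s) (velocity γ 0) (x s) (g 0) -
    intersectionIndex (velocity Y t) (velocity γ 1) (y t) (g 1)

/-- A double pair: two disjoint arcs `X, Y` and two distinct non-trivial boundary paths `γ, γ'`
from `X` to `Y` that close up to a loop, either with each other (same ends of `X` and of `Y`, which
needs a boundary circle in `M`) or with both arcs (`X · γ · Y · γ'⁻¹`, different ends of `X` and of
`Y`). -/
structure IsDoublePair (M : Set ℂ) (X Y γ γ' : ℝ → ℂ) (s t s' t' : ℝ) : Prop where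
  arc_left : IsArc M X
  arc_right : IsArc M Y
  disjoint : Disjoint (X '' Icc 0 1) (Y '' Icc 0 1)
  path : IsBoundaryPath M X Y γ s t
  path' : IsBoundaryPath M X Y γ' s' t'
  distinct : ∃ u ∈ Icc (0 : ℝ) 1, γ u ≠ γ' u
  loop : s = s' ↔ t = t'

/-- A foliation is balanced for the marking `M` if in every double pair both boundary paths have
the same degree. -/
def IsBalanced (M : Set ℂ) (η : Foliation) : Prop :=
  ∀ (X Y γ γ' : ℝ → ℂ) (s t s' t' : ℝ), IsDoublePair M X Y γ γ' s t s' t' →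
    ∀ x y g g' : ℝ → ℝ, IsGrading η X x → IsGrading η Y y → IsGrading η γ g → IsGrading η γ' g' →
      pathDegree X Y γ s t x y g = pathDegree X Y γ' s' t' x y g'

/-! ### Closed curves -/

/-- A closed curve (with period `1`) is null-homotopic in the annulus. -/
def IsNullhomotopic (γ : ℝ → ℂ) : Prop :=
  ∃ H : ℝ × ℝ → ℂ, ContinuousOn H (Icc 0 1 ×ˢ Icc 0 1) ∧
    (∀ s ∈ Icc (0 : ℝ) 1, ∀ t ∈ Icc (0 : ℝ) 1, H (s, t) ∈ annulus) ∧
    (∀ t ∈ Icc (0 : ℝ) 1, H (0, t) = γ t) ∧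
    (∀ s ∈ Icc (0 : ℝ) 1, H (s, 0) = H (s, 1)) ∧
    (∀ t ∈ Icc (0 : ℝ) 1, H (1, t) = H (1, 0))

/-- A smooth embedded closed curve in the annulus that is unobstructed, that is, does not bound a
disk. -/
structure IsUnobstructedClosedCurve (γ : ℝ → ℂ) : Prop where
  smooth : ContDiff ℝ ∞ γ
  periodic : Function.Periodic γ 1
  mem : ∀ t, γ t ∈ annulus
  immersed : ∀ t, deriv γ t ≠ 0
  injOn : InjOn γ (Ico 0 1)
  not_nullhomotopic : ¬ IsNullhomotopic γ

/-- `η ∗ γ = 0` for all unobstructed embedded closed curves `γ`. Here `η ∗ γ` is the winding number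
of the tangent line of `γ` around `η`: for a grading `a` along one period it is
`(a 0 - a 1) / π`. -/
def WindsTrivially (η : Foliation) : Prop :=
  ∀ γ : ℝ → ℂ, IsUnobstructedClosedCurve γ → ∀ a : ℝ → ℝ, IsGrading η γ a →
    (a 0 - a 1) / Real.pi = 0

end AnnulusFoliation

end

/-! In the coordinate `w = log z` the annulus becomes the strip `0 ≤ Re w ≤ log 2` modulo `2πi`, and
the rotation-invariant frame becomes constant. A foliation then has a continuous angle `ψ w` against
the circle direction, and `ψ` grows by `d π` over one turn for a single integer `d`
(`exists_isAngle`, `IsAngle.unique`). Each of the three conditions, and membership in the class of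
the foliation by concentric circles, is shown to be equivalent to `d = 0`.

For the class: `d` is constant along a homotopy, and for `d = 0` the angle descends to the annulus
and can be scaled to zero. For the degree: passing from lines to the circle doubles angles, so the
circle map has degree `d`.

Necessity of `d = 0` in the other two conditions comes from test objects. The inner circle has
winding number `-d`. Every marking admits a double pair of two crossing spirals whose loop `X · γ ·
Y · γ'⁻¹` goes once around the annulus, and its two degrees differ by `d`.

Sufficiency is a turning argument in the style of Hopf. For `d = 0` the foliation contributes a
single-valued term, which cancels, so only the turning of the curve in the strip matters. The secant
map of an embedded lift is nowhere zero on the parameter square or plane, so it has a continuous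
logarithm, and the tangent on the diagonal can be compared with secants along the edges. A closed
curve that is not null-homotopic lifts to a curve with a translation symmetry and has total turning
zero. An arc between the two boundary circles has equal indices at its ends
(`endIndex_eq_of_crossing`). An arc returning to the same circle has index larger by one at the
upper end of its lift (`endIndex_eq_of_returning`).

The degree of a boundary path is the difference of the indices at the ends it joins
(`pathDegree_eq`). For crossing arcs balance is then immediate. For returning arcs, upper ends must
be joined to upper ends and lower to lower. Otherwise essentiality of the arcs, through unmarked
points below their lifts' chords, forces interleaved endpoints, and the arcs would meet
(`im_lt_im_of_path`, `exists_eq_of_interleaved`). -/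

namespace AnnulusFoliation

/-! ### Continuous logarithms and angles -/

/-- A nowhere vanishing function on a simply connected space has a continuous logarithm. -/
lemma exists_continuous_log {A : Type*} [TopologicalSpace A] [SimplyConnectedSpace A]
    [LocallyPathConnectedSpace A] {f : A → ℂ} (hf : Continuous f) (h0 : ∀ a, f a ≠ 0) :
    ∃ L : A → ℂ, Continuous L ∧ ∀ a, Complex.exp (L a) = f a := by
  obtain ⟨a₀⟩ : Nonempty A := inferInstance
  obtain ⟨L, ⟨-, hL⟩, -⟩ := Complex.isCoveringMapOn_exp.existsUnique_continuousMap_lifts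
    ⟨f, hf⟩ (a₀ := a₀) (e₀ := Complex.log (f a₀)) (Complex.exp_log (h0 a₀)) h0
  exact ⟨L, L.continuous, fun a => congrFun hL a⟩

/-- A circle-valued function on a simply connected space has a continuous angle. -/
lemma exists_continuous_angle {A : Type*} [TopologicalSpace A] [SimplyConnectedSpace A]
    [LocallyPathConnectedSpace A] {f : A → Circle} (hf : Continuous f) :
    ∃ φ : A → ℝ, Continuous φ ∧ ∀ a, Circle.exp (φ a) = f a := by
  obtain ⟨a₀⟩ : Nonempty A := inferInstance
  obtain ⟨φ, ⟨-, hφ⟩, -⟩ := Circle.isCoveringMap_exp.existsUnique_continuousMap_lifts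
    ⟨f, hf⟩ a₀ (Complex.arg (f a₀)) (Circle.exp_arg _)
  exact ⟨φ, φ.continuous, fun a => congrFun hφ a⟩

/-- A continuous function with values in a translate of `ℤ p` is constant. -/
lemma eq_of_mem_int_multiples {A : Type*} [TopologicalSpace A] {S : Set A} (hS : IsPreconnected S)
    {f : A → ℝ} (hf : ContinuousOn f S) {p : ℝ} (hp : 0 < p) (c : ℝ)
    (h : ∀ x ∈ S, ∃ n : ℤ, f x = c + n * p) {x y : A} (hx : x ∈ S) (hy : y ∈ S) :
    f x = f y := by
  have key : ∀ x ∈ S, ∀ y ∈ S, f x ≤ f y := by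
    intro x hx y hy
    by_contra hlt
    rw [not_le] at hlt
    obtain ⟨n, hn⟩ := h x hx
    obtain ⟨m, hm⟩ := h y hy
    have hmn : m < n := by
      have : (m : ℝ) * p < n * p := by linarith
      exact_mod_cast lt_of_mul_lt_mul_right this hp.le
    have hmn' : (m : ℝ) + 1 ≤ n := by exact_mod_cast hmn
    -- The point half a step above the lower value lies in no translate `c + ℤ p`, yet a connected
    -- domain would force `f` to attain it.
    obtain ⟨z, hz, hfz⟩ := hS.intermediate_value hy hx hf
      (show c + (m + 1 / 2) * p ∈ Icc (f y) (f x) from ⟨by nlinarith, by nlinarith⟩)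
    obtain ⟨k, hk⟩ := h z hz
    have h2 : (k : ℝ) = m + 1 / 2 := mul_right_cancel₀ hp.ne' (by linarith)
    have h3 : (2 * k : ℤ) = 2 * m + 1 := by
      have : (2 * k : ℝ) = 2 * m + 1 := by linarith
      exact_mod_cast this
    omega
  exact le_antisymm (key x hx y hy) (key y hy x hx)

/-! ### Confinement of angles to half-turns. -/

/-- A continuous angle with nonnegative cosine stays in one interval of length `π`. -/
lemma exists_forall_mem_Icc_of_cos_nonneg {S : Set ℝ} (hS : IsPreconnected S) {x₀ : ℝ}
    (hx₀ : x₀ ∈ S) {φ : ℝ → ℝ} (hφ : ContinuousOn φ S) (h : ∀ x ∈ S, 0 ≤ Real.cos (φ x)) :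
    ∃ k : ℤ, ∀ x ∈ S, φ x ∈ Icc (2 * k * Real.pi - Real.pi / 2) (2 * k * Real.pi + Real.pi / 2) := by
  have hpi := Real.pi_pos
  obtain ⟨k, hk, -⟩ := existsUnique_zsmul_near_of_pos (show 0 < 2 * Real.pi by positivity)
    (φ x₀ + Real.pi)
  rw [zsmul_eq_mul, zsmul_eq_mul] at hk
  push_cast at hk
  have hshift : ∀ (t : ℝ) (m : ℤ), Real.cos (t + m * (2 * Real.pi)) = Real.cos t :=
    fun t m => Real.cos_add_int_mul_two_pi t m
  have hneg : ∀ θ, Real.pi / 2 < θ - 2 * k * Real.pi → θ - 2 * k * Real.pi < 3 * Real.pi / 2 →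
      Real.cos θ < 0 := by
    intro θ h1 h2
    have := Real.cos_neg_of_pi_div_two_lt_of_lt h1 (by linarith)
    rwa [← hshift _ k, show θ - 2 * k * Real.pi + k * (2 * Real.pi) = θ by ring] at this
  have hneg' : ∀ θ, -(3 * Real.pi / 2) < θ - 2 * k * Real.pi → θ - 2 * k * Real.pi < -(Real.pi / 2) →
      Real.cos θ < 0 := by
    intro θ h1 h2
    have := Real.cos_neg_of_pi_div_two_lt_of_lt (x := -(θ - 2 * k * Real.pi)) (by linarith)
      (by linarith)
    rwa [Real.cos_neg, ← hshift _ k,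
      show θ - 2 * k * Real.pi + k * (2 * Real.pi) = θ by ring] at this
  have h0 := h x₀ hx₀
  have hx1 : φ x₀ ≤ 2 * k * Real.pi + Real.pi / 2 := by
    by_contra hc
    exact absurd (hneg (φ x₀) (by linarith) (by linarith [hk.2])) (not_lt.2 h0)
  have hx2 : 2 * k * Real.pi - Real.pi / 2 ≤ φ x₀ := by
    by_contra hc
    exact absurd (hneg' (φ x₀) (by linarith [hk.1]) (by linarith)) (not_lt.2 h0)
  refine ⟨k, fun x hx => ⟨?_, ?_⟩⟩
  · by_contra hc
    rw [not_le] at hc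
    -- Truncating at `2kπ - π` keeps the intermediate value inside the gap where the cosine is
    -- negative, even if `φ x` lies many turns away.
    have hm : max (φ x) (2 * k * Real.pi - Real.pi) ∈ Icc (φ x) (φ x₀) :=
      ⟨le_max_left _ _, max_le (by linarith) (by linarith)⟩
    obtain ⟨z, hz, hfz⟩ := hS.intermediate_value hx hx₀ hφ hm
    refine absurd (hneg' (φ z) ?_ ?_) (not_lt.2 (h z hz)) <;> rw [hfz]
    · linarith [le_max_right (φ x) (2 * k * Real.pi - Real.pi)]
    · have : max (φ x) (2 * k * Real.pi - Real.pi) < 2 * k * Real.pi - Real.pi / 2 :=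
        max_lt hc (by linarith)
      linarith
  · by_contra hc
    rw [not_le] at hc
    have hm : min (φ x) (2 * k * Real.pi + Real.pi) ∈ Icc (φ x₀) (φ x) :=
      ⟨le_min (by linarith) (by linarith), min_le_left _ _⟩
    obtain ⟨z, hz, hfz⟩ := hS.intermediate_value hx₀ hx hφ hm
    refine absurd (hneg (φ z) ?_ ?_) (not_lt.2 (h z hz)) <;> rw [hfz]
    · have : 2 * k * Real.pi + Real.pi / 2 < min (φ x) (2 * k * Real.pi + Real.pi) :=
        lt_min hc (by linarith)
      linarith
    · linarith [min_le_right (φ x) (2 * k * Real.pi + Real.pi)]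

/-- A continuous logarithm along a preconnected set of a function with values in the right closed
half-plane has its imaginary part in one interval of length `π`. -/
lemma exists_im_mem_Icc_of_re_nonneg {S : Set ℝ} (hS : IsPreconnected S) {x₀ : ℝ}
    (hx₀ : x₀ ∈ S) {ℓ : ℝ → ℂ} (hℓ : ContinuousOn ℓ S)
    (h : ∀ x ∈ S, 0 ≤ (Complex.exp (ℓ x)).re) :
    ∃ k : ℤ, ∀ x ∈ S,
      (ℓ x).im ∈ Icc (2 * k * Real.pi - Real.pi / 2) (2 * k * Real.pi + Real.pi / 2) := by
  refine exists_forall_mem_Icc_of_cos_nonneg hS hx₀ (Complex.continuous_im.comp_continuousOn hℓ)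
    fun x hx => ?_
  have := h x hx
  rw [Complex.exp_re] at this
  exact nonneg_of_mul_nonneg_right this (Real.exp_pos _)

/-- The analogous statement for the left closed half-plane. -/
lemma exists_im_mem_Icc_of_re_nonpos {S : Set ℝ} (hS : IsPreconnected S) {x₀ : ℝ}
    (hx₀ : x₀ ∈ S) {ℓ : ℝ → ℂ} (hℓ : ContinuousOn ℓ S)
    (h : ∀ x ∈ S, (Complex.exp (ℓ x)).re ≤ 0) :
    ∃ k : ℤ, ∀ x ∈ S,
      (ℓ x).im ∈ Icc (2 * k * Real.pi + Real.pi / 2) (2 * k * Real.pi + 3 * Real.pi / 2) := by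
  obtain ⟨k, hk⟩ := exists_im_mem_Icc_of_re_nonneg hS hx₀
    (ℓ := fun x => ℓ x - Real.pi * Complex.I) (hℓ.sub continuousOn_const) (fun x hx => by
      rw [Complex.exp_sub, Complex.exp_pi_mul_I, div_neg, div_one, Complex.neg_re]
      exact neg_nonneg.2 (h x hx))
  refine ⟨k, fun x hx => ?_⟩
  have := hk x hx
  simp only [Complex.sub_im, Complex.mul_im, Complex.ofReal_re, Complex.I_im, mul_one,
    Complex.ofReal_im, Complex.I_re, mul_zero, add_zero] at this
  exact ⟨by linarith [this.1], by linarith [this.2]⟩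

/-- The bridge from overlapping half-turn intervals to inequalities between integers, which `omega`
can then combine. -/
lemma int_le_of_mul_pi_lt {m k : ℤ} (h : 2 * m * Real.pi < 2 * k * Real.pi + 2 * Real.pi) :
    m ≤ k := by
  have h1 : (m : ℝ) < k + 1 := by
    have := Real.pi_pos
    by_contra hc
    rw [not_lt] at hc
    nlinarith
  exact Int.lt_add_one_iff.1 (by exact_mod_cast h1)

lemma exists_im_eq_of_exp_eq_pos {z : ℂ} {y : ℝ} (hy : 0 < y)
    (h : Complex.exp z = y * Complex.I) : ∃ m : ℤ, z.im = 2 * m * Real.pi + Real.pi / 2 := by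
  have h1 : Complex.exp z = Complex.exp (Real.log y + (Real.pi / 2 : ℝ) * Complex.I) := by
    rw [h, Complex.exp_add, ← Complex.ofReal_exp, Real.exp_log hy]
    push_cast
    rw [Complex.exp_pi_div_two_mul_I]
  obtain ⟨m, hm⟩ := Complex.exp_eq_exp_iff_exists_int.1 h1
  refine ⟨m, ?_⟩
  have := congrArg Complex.im hm
  simp at this
  linarith

lemma exists_im_eq_of_exp_eq_neg {z : ℂ} {y : ℝ} (hy : y < 0)
    (h : Complex.exp z = y * Complex.I) : ∃ m : ℤ, z.im = 2 * m * Real.pi - Real.pi / 2 := by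
  obtain ⟨m, hm⟩ := exists_im_eq_of_exp_eq_pos (z := z + Real.pi * Complex.I) (y := -y)
    (by linarith) (by rw [Complex.exp_add, Complex.exp_pi_mul_I, h]; push_cast; ring)
  refine ⟨m, ?_⟩
  simp at hm
  linarith

/-! ### Crossing of curves with interleaved endpoints. -/

/-- The retraction of the line to the unit interval. -/
noncomputable def clamp (t : ℝ) : ℝ := max 0 (min 1 t)

lemma continuous_clamp : Continuous clamp := by unfold clamp; fun_prop

lemma clamp_mem (t : ℝ) : clamp t ∈ Icc (0 : ℝ) 1 :=
  ⟨le_max_left _ _, max_le zero_le_one (min_le_left _ _)⟩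

lemma clamp_of_mem {t : ℝ} (ht : t ∈ Icc (0 : ℝ) 1) : clamp t = t := by
  rw [clamp, min_eq_right ht.2, max_eq_right ht.1]

lemma zero_mem_unit : (0 : ℝ) ∈ Icc (0 : ℝ) 1 := ⟨le_rfl, zero_le_one⟩

lemma one_mem_unit : (1 : ℝ) ∈ Icc (0 : ℝ) 1 := ⟨zero_le_one, le_rfl⟩

lemma eq_im_mul_I {z : ℂ} (h : z.re = 0) : z = z.im * Complex.I := by
  apply Complex.ext <;> simp [h]

/-- Two curves in the closed right half-plane with interleaved endpoints on the imaginary axis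
meet. -/
lemma exists_eq_of_interleaved {α β : ℝ → ℂ} (hα : ContinuousOn α (Icc 0 1))
    (hβ : ContinuousOn β (Icc 0 1)) (hα' : ∀ t ∈ Icc (0 : ℝ) 1, 0 ≤ (α t).re)
    (hβ' : ∀ t ∈ Icc (0 : ℝ) 1, 0 ≤ (β t).re) (hα0 : (α 0).re = 0) (hα1 : (α 1).re = 0)
    (hβ0 : (β 0).re = 0) (hβ1 : (β 1).re = 0) (h1 : (α 0).im < (β 0).im)
    (h2 : (β 0).im < (α 1).im) (h3 : (α 1).im < (β 1).im) :
    ∃ s ∈ Icc (0 : ℝ) 1, ∃ t ∈ Icc (0 : ℝ) 1, α s = β t := by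
  by_contra! hne
  have hpi := Real.pi_pos
  -- If the curves never met, `α s - β t` would be nowhere zero on the square. Composing with
  -- `clamp` extends it to the plane, where it has a logarithm.
  have hc : ∀ {f : ℝ → ℂ}, ContinuousOn f (Icc 0 1) → Continuous fun t => f (clamp t) :=
    fun hf => hf.comp_continuous continuous_clamp clamp_mem
  obtain ⟨L, hL, hexp⟩ := exists_continuous_log (A := ℝ × ℝ)
    (f := fun p => α (clamp p.1) - β (clamp p.2))
    (((hc hα).comp continuous_fst).sub ((hc hβ).comp continuous_snd))
    (fun p => sub_ne_zero.2 (hne _ (clamp_mem _) _ (clamp_mem _)))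
  have c0 := clamp_of_mem zero_mem_unit
  have c1 := clamp_of_mem one_mem_unit
  have hval : ∀ a b : ℝ, (α (clamp a) - β (clamp b)).re = 0 →
      Complex.exp (L (a, b)) = ((α (clamp a) - β (clamp b)).im : ℝ) * Complex.I := by
    intro a b h
    rw [hexp]
    exact eq_im_mul_I h
  obtain ⟨m00, h00⟩ := exists_im_eq_of_exp_eq_neg (by rw [c0, Complex.sub_im]; linarith)
    (hval 0 0 (by rw [c0, Complex.sub_re]; linarith))
  obtain ⟨m01, h01⟩ := exists_im_eq_of_exp_eq_neg (by rw [c0, c1, Complex.sub_im]; linarith)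
    (hval 0 1 (by rw [c0, c1, Complex.sub_re]; linarith))
  obtain ⟨m10, h10⟩ := exists_im_eq_of_exp_eq_pos (by rw [c0, c1, Complex.sub_im]; linarith)
    (hval 1 0 (by rw [c0, c1, Complex.sub_re]; linarith))
  obtain ⟨m11, h11⟩ := exists_im_eq_of_exp_eq_neg (by rw [c1, Complex.sub_im]; linarith)
    (hval 1 1 (by rw [c1, Complex.sub_re]; linarith))
  have hleft : ∀ a : ℝ, (α (clamp a)).re = 0 → ∃ k : ℤ, ∀ x ∈ Icc (0 : ℝ) 1,
      (L (a, x)).im ∈ Icc (2 * k * Real.pi + Real.pi / 2) (2 * k * Real.pi + 3 * Real.pi / 2) :=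
    fun a ha => exists_im_mem_Icc_of_re_nonpos isPreconnected_Icc zero_mem_unit
      (by fun_prop) (fun x _ => by
        rw [hexp, Complex.sub_re, ha]
        linarith [hβ' _ (clamp_mem x)])
  have hright : ∀ b : ℝ, (β (clamp b)).re = 0 → ∃ k : ℤ, ∀ x ∈ Icc (0 : ℝ) 1,
      (L (x, b)).im ∈ Icc (2 * k * Real.pi - Real.pi / 2) (2 * k * Real.pi + Real.pi / 2) :=
    fun b hb => exists_im_mem_Icc_of_re_nonneg isPreconnected_Icc zero_mem_unit
      (by fun_prop) (fun x _ => by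
        rw [hexp, Complex.sub_re, hb]
        linarith [hα' _ (clamp_mem x)])
  obtain ⟨k1, hk1⟩ := hleft 0 (by rw [c0, hα0])
  obtain ⟨k2, hk2⟩ := hleft 1 (by rw [c1, hα1])
  obtain ⟨k3, hk3⟩ := hright 0 (by rw [c0, hβ0])
  obtain ⟨k4, hk4⟩ := hright 1 (by rw [c1, hβ1])
  have e1 := hk1 0 zero_mem_unit
  have e2 := hk1 1 one_mem_unit
  have e3 := hk2 0 zero_mem_unit
  have e4 := hk2 1 one_mem_unit
  have e5 := hk3 0 zero_mem_unit
  have e6 := hk3 1 one_mem_unit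
  have e7 := hk4 0 zero_mem_unit
  have e8 := hk4 1 one_mem_unit
  rw [h00] at e1 e5
  rw [h01] at e2 e7
  rw [h10] at e3 e6
  rw [h11] at e4 e8
  -- Go round the square through `(0,0)`, `(1,0)`, `(1,1)`, `(0,1)`. The first two edges take the
  -- difference from down to up through the right half-plane and back to down through the left one,
  -- a full turn. The last two begin and end pointing down within one half-plane and contribute
  -- nothing. The chain gives `m00 + 1 ≤ m11 ≤ m00`.
  have i1 : m00 ≤ k3 := int_le_of_mul_pi_lt (by linarith [e5.2])
  have i2 : k3 ≤ m10 := int_le_of_mul_pi_lt (by linarith [e6.1])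
  have i3 : m10 ≤ k2 := int_le_of_mul_pi_lt (by linarith [e3.2])
  have i4 : k2 + 1 ≤ m11 := int_le_of_mul_pi_lt (by push_cast; linarith [e4.1])
  have i5 : m11 ≤ k4 := int_le_of_mul_pi_lt (by linarith [e8.2])
  have i6 : k4 ≤ m01 := int_le_of_mul_pi_lt (by linarith [e7.1])
  have i7 : m01 ≤ k1 + 1 := int_le_of_mul_pi_lt (by push_cast; linarith [e2.2])
  have i8 : k1 + 1 ≤ m00 := int_le_of_mul_pi_lt (by push_cast; linarith [e1.1])
  omega

/-! ### Logarithms and secants of curves -/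

/-- A curve with logarithmic derivative `G` is the exponential of a primitive of `G`. -/
lemma exists_primitive_exp_eq {K : Set ℝ} (hK : Convex ℝ K) (h0 : (0 : ℝ) ∈ K) {X G : ℝ → ℂ}
    (hG : Continuous G) (hX : ∀ t ∈ K, HasDerivWithinAt X (G t * X t) K t) {w : ℂ}
    (hw : Complex.exp w = X 0) :
    ∃ Γ : ℝ → ℂ, (∀ t, HasDerivAt Γ (G t) t) ∧ Γ 0 = w ∧ ∀ t ∈ K, Complex.exp (Γ t) = X t := by
  refine ⟨fun t => w + ∫ v in (0 : ℝ)..t, G v, ?_, by simp, ?_⟩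
  · intro t
    exact ((hG.integral_hasStrictDerivAt 0 t).hasDerivAt).const_add w
  · intro t ht
    set Γ : ℝ → ℂ := fun t => w + ∫ v in (0 : ℝ)..t, G v with hΓ
    have hd : ∀ t, HasDerivAt Γ (G t) t := fun t =>
      ((hG.integral_hasStrictDerivAt 0 t).hasDerivAt).const_add w
    -- `exp (-Γ) * X` has derivative zero on the convex set `K`, so it keeps its value `1` at `0`.
    have hconst := hK.norm_image_sub_le_of_norm_hasDerivWithin_le (C := 0)
      (f := fun t => Complex.exp (-Γ t) * X t) (f' := fun _ => 0)
      (fun t ht => by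
        have h1 := ((hd t).neg.cexp.hasDerivWithinAt (s := K)).mul (hX t ht)
        exact h1.congr_deriv (by ring)) (fun _ _ => by simp) h0 ht
    have h2 : Complex.exp (-Γ t) * X t = 1 := by
      rw [zero_mul, norm_le_zero_iff, sub_eq_zero] at hconst
      rw [hconst, ← hw, show Γ 0 = w by simp [hΓ], ← Complex.exp_add, neg_add_cancel,
        Complex.exp_zero]
    calc Complex.exp (Γ t) = Complex.exp (Γ t) * (Complex.exp (-Γ t) * X t) := by rw [h2, mul_one]
      _ = X t := by rw [← mul_assoc, ← Complex.exp_add, add_neg_cancel, Complex.exp_zero, one_mul]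

/-- The slope of the secant between the parameters `p.1` and `p.2` of a primitive of `G`. -/
noncomputable def secant (G : ℝ → ℂ) (p : ℝ × ℝ) : ℂ :=
  ∫ v in (0 : ℝ)..1, G (p.1 + (p.2 - p.1) * v)

/-- The reason for the integral form: it extends the difference quotient continuously across the
diagonal, where it becomes the tangent. -/
lemma continuous_secant {G : ℝ → ℂ} (hG : Continuous G) : Continuous (secant G) := by
  unfold secant
  apply intervalIntegral.continuous_parametric_intervalIntegral_of_continuous'
  unfold Function.uncurry
  fun_prop

lemma secant_self (G : ℝ → ℂ) (t : ℝ) : secant G (t, t) = G t := by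
  simp [secant]

lemma mul_secant {Γ G : ℝ → ℂ} (hG : Continuous G) (hΓ : ∀ t, HasDerivAt Γ (G t) t) (a b : ℝ) :
    ((b - a : ℝ) : ℂ) * secant G (a, b) = Γ b - Γ a := by
  have h := intervalIntegral.smul_integral_comp_add_mul (a := 0) (b := 1) G (b - a) a
  rw [secant, ← Complex.real_smul, h, intervalIntegral.integral_eq_sub_of_hasDerivAt
    (fun x _ => hΓ x) (hG.intervalIntegrable _ _)]
  simp

/-- Injectivity handles distinct parameters and immersedness handles the diagonal, so embedded
curves have a continuous direction angle for all secants at once. -/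
lemma secant_ne_zero {Γ G : ℝ → ℂ} (hG : Continuous G) (hΓ : ∀ t, HasDerivAt Γ (G t) t) {K : Set ℝ}
    (hG0 : ∀ t ∈ K, G t ≠ 0) (hinj : InjOn Γ K) {a b : ℝ} (ha : a ∈ K) (hb : b ∈ K) :
    secant G (a, b) ≠ 0 := by
  rcases eq_or_ne a b with rfl | hab
  · rw [secant_self]
    exact hG0 a ha
  · intro h
    have := mul_secant hG hΓ a b
    rw [h, mul_zero, eq_comm, sub_eq_zero] at this
    exact hab (hinj ha hb this.symm)

/-- The direction angle of an injective curve that advances by a fixed nonzero vector over every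
period returns to its initial value. -/
lemma exists_log_deriv_eq_of_translation {Γ G : ℝ → ℂ} (hG : Continuous G)
    (hΓ : ∀ t, HasDerivAt Γ (G t) t) (hG0 : ∀ t, G t ≠ 0) (hinj : Function.Injective Γ) {c : ℂ}
    (hper : ∀ t, Γ (t + 1) = Γ t + c) :
    ∃ ℓ : ℝ → ℂ, Continuous ℓ ∧ (∀ t, Complex.exp (ℓ t) = G t) ∧ (ℓ 0).im = (ℓ 1).im := by
  obtain ⟨L, hL, hexp⟩ := exists_continuous_log (continuous_secant hG)
    (fun p => secant_ne_zero (K := univ) hG hΓ (fun t _ => hG0 t) hinj.injOn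
      (mem_univ p.1) (mem_univ p.2))
  have hGper : ∀ t, G (t + 1) = G t := by
    intro t
    have h1 : HasDerivAt (fun s => Γ (s + 1)) (G (t + 1)) t := by
      simpa using (hΓ (t + 1)).comp_add_const t 1
    have h2 : HasDerivAt (fun s => Γ (s + 1)) (G t) t := by
      simp only [hper]
      exact (hΓ t).add_const c
    exact h1.unique h2
  have hsper : ∀ a b, secant G (a + 1, b + 1) = secant G (a, b) := by
    intro a b
    unfold secant
    congr 1
    ext v
    rw [← hGper (a + _)]
    congr 1
    ring
  have hpi := Real.pi_pos
  have hint : ∀ {z w : ℂ}, Complex.exp z = Complex.exp w →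
      ∃ n : ℤ, z.im - w.im = 0 + n * (2 * Real.pi) := by
    intro z w h
    obtain ⟨n, hn⟩ := Complex.exp_eq_exp_iff_exists_int.1 h
    refine ⟨n, ?_⟩
    rw [hn]
    simp
  -- Secants are invariant under the shift by `(1,1)`, so the increment of the angle under it is a
  -- multiple of `2π` and hence constant on the plane. It may be computed at `(0,1)` in place of
  -- `(0,0)`.
  have hconst : (L (0 + 1, 0 + 1)).im - (L (0, 0)).im = (L (0 + 1, 1 + 1)).im - (L (0, 1)).im :=
    eq_of_mem_int_multiples (A := ℝ × ℝ) (S := univ) isPreconnected_univ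
      (f := fun p => (L (p.1 + 1, p.2 + 1)).im - (L (p.1, p.2)).im)
      (by fun_prop) (by positivity) 0
      (fun p _ => hint (by rw [hexp, hexp, hsper])) (x := (0, 0)) (y := (0, 1)) trivial trivial
  -- Along `a ↦ (a, a + 1)` every secant equals `c`, so the angle there does not move at all.
  have hdiag : (L (0 + 1, 0 + 1 + 1)).im - (L (0, 0 + 1)).im = 0 := by
    have hsec : ∀ a, secant G (a, a + 1) = c := by
      intro a
      have := mul_secant hG hΓ a (a + 1)
      rw [hper] at this
      simpa using this
    have := eq_of_mem_int_multiples (A := ℝ) (S := univ) isPreconnected_univ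
      (f := fun a => (L (a, a + 1)).im - (L (0, 0 + 1)).im)
      (by fun_prop) (p := 2 * Real.pi) (by positivity) 0
      (fun a _ => hint (by rw [hexp, hexp, hsec, hsec])) (x := 0 + 1) (y := 0) trivial trivial
    simpa using this
  refine ⟨fun t => L (t, t), by fun_prop, fun t => by rw [hexp, secant_self], ?_⟩
  norm_num at hconst hdiag ⊢
  linarith

/-- A continuous logarithm of the secants of an injective curve on the unit square. -/
lemma exists_log_secant {Γ G : ℝ → ℂ} (hG : Continuous G) (hΓ : ∀ t, HasDerivAt Γ (G t) t)
    (hG0 : ∀ t ∈ Icc (0 : ℝ) 1, G t ≠ 0) (hinj : InjOn Γ (Icc 0 1)) :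
    ∃ L : ℝ × ℝ → ℂ, Continuous L ∧ ∀ a ∈ Icc (0 : ℝ) 1, ∀ b ∈ Icc (0 : ℝ) 1,
      Complex.exp (L (a, b)) = secant G (a, b) := by
  have hcl := continuous_clamp
  have hs := continuous_secant hG
  obtain ⟨L, hL, hexp⟩ := exists_continuous_log (A := ℝ × ℝ)
    (f := fun p => secant G (clamp p.1, clamp p.2)) (by fun_prop)
    (fun p => secant_ne_zero hG hΓ hG0 hinj (clamp_mem _) (clamp_mem _))
  refine ⟨L, hL, fun a ha b hb => ?_⟩
  rw [hexp, clamp_of_mem ha, clamp_of_mem hb]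

/-! ### The turning of arcs in a strip -/

lemma re_secant_mul {Γ G : ℝ → ℂ} (hG : Continuous G) (hΓ : ∀ t, HasDerivAt Γ (G t) t) (a b : ℝ) :
    (b - a) * (secant G (a, b)).re = (Γ b).re - (Γ a).re := by
  have := congrArg Complex.re (mul_secant hG hΓ a b)
  rwa [Complex.re_ofReal_mul, Complex.sub_re] at this

lemma re_secant_nonneg {Γ G : ℝ → ℂ} (hG : Continuous G) (hΓ : ∀ t, HasDerivAt Γ (G t) t)
    {a b : ℝ} (hab : a < b) (h : (Γ a).re ≤ (Γ b).re) : 0 ≤ (secant G (a, b)).re := by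
  have := re_secant_mul hG hΓ a b
  exact nonneg_of_mul_nonneg_right (by linarith : 0 ≤ (b - a) * _) (sub_pos.2 hab)

lemma re_secant_nonpos {Γ G : ℝ → ℂ} (hG : Continuous G) (hΓ : ∀ t, HasDerivAt Γ (G t) t)
    {a b : ℝ} (hab : a < b) (h : (Γ b).re ≤ (Γ a).re) : (secant G (a, b)).re ≤ 0 := by
  have := re_secant_mul hG hΓ a b
  exact nonpos_of_mul_nonpos_right (by linarith : (b - a) * _ ≤ 0) (sub_pos.2 hab)

lemma mem_Ioo_of_cos_pos {k : ℤ} {θ : ℝ}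
    (h : θ ∈ Icc (2 * k * Real.pi - Real.pi / 2) (2 * k * Real.pi + Real.pi / 2))
    (hc : 0 < Real.cos θ) :
    θ ∈ Ioo (2 * k * Real.pi - Real.pi / 2) (2 * k * Real.pi + Real.pi / 2) := by
  have hs : ∀ t : ℝ, Real.cos (t + k * (2 * Real.pi)) = Real.cos t :=
    fun t => Real.cos_add_int_mul_two_pi t k
  refine ⟨lt_of_le_of_ne h.1 ?_, lt_of_le_of_ne h.2 ?_⟩
  · rintro rfl
    rw [show 2 * k * Real.pi - Real.pi / 2 = -(Real.pi / 2) + k * (2 * Real.pi) by ring, hs,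
      Real.cos_neg, Real.cos_pi_div_two] at hc
    exact lt_irrefl _ hc
  · rintro rfl
    rw [show 2 * k * Real.pi + Real.pi / 2 = Real.pi / 2 + k * (2 * Real.pi) by ring, hs,
      Real.cos_pi_div_two] at hc
    exact lt_irrefl _ hc

lemma im_mem_Ioo_of_re_pos {k : ℤ} {z : ℂ}
    (h : z.im ∈ Icc (2 * k * Real.pi - Real.pi / 2) (2 * k * Real.pi + Real.pi / 2))
    (hc : 0 < (Complex.exp z).re) :
    z.im ∈ Ioo (2 * k * Real.pi - Real.pi / 2) (2 * k * Real.pi + Real.pi / 2) := by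
  rw [Complex.exp_re] at hc
  exact mem_Ioo_of_cos_pos h (pos_of_mul_pos_right hc (Real.exp_pos _).le)

lemma im_mem_Ioo_of_re_neg {k : ℤ} {z : ℂ}
    (h : z.im ∈ Icc (2 * k * Real.pi + Real.pi / 2) (2 * k * Real.pi + 3 * Real.pi / 2))
    (hc : (Complex.exp z).re < 0) :
    z.im ∈ Ioo (2 * k * Real.pi + Real.pi / 2) (2 * k * Real.pi + 3 * Real.pi / 2) := by
  have := im_mem_Ioo_of_re_pos (k := k) (z := z - Real.pi * Complex.I)
    (by simp; constructor <;> linarith [h.1, h.2])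
    (by rw [Complex.exp_sub, Complex.exp_pi_mul_I, div_neg, div_one, Complex.neg_re]; linarith)
  simp at this
  exact ⟨by linarith [this.1], by linarith [this.2]⟩

/-- An arc that crosses a vertical strip has directions in the same half-turn at both ends. -/
lemma exists_log_deriv_of_crossing {Γ G : ℝ → ℂ} (hG : Continuous G)
    (hΓ : ∀ t, HasDerivAt Γ (G t) t) (hG0 : ∀ t ∈ Icc (0 : ℝ) 1, G t ≠ 0)
    (hinj : InjOn Γ (Icc 0 1)) (hmin : ∀ t ∈ Icc (0 : ℝ) 1, (Γ 0).re ≤ (Γ t).re)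
    (hmax : ∀ t ∈ Icc (0 : ℝ) 1, (Γ t).re ≤ (Γ 1).re) (h0 : 0 < (G 0).re) (h1 : 0 < (G 1).re) :
    ∃ ℓ : ℝ → ℂ, Continuous ℓ ∧ (∀ t ∈ Icc (0 : ℝ) 1, Complex.exp (ℓ t) = G t) ∧ ∃ κ : ℤ,
      (ℓ 0).im ∈ Ioo (κ * Real.pi - Real.pi / 2) (κ * Real.pi + Real.pi / 2) ∧
      (ℓ 1).im ∈ Ioo (κ * Real.pi - Real.pi / 2) (κ * Real.pi + Real.pi / 2) := by
  obtain ⟨L, hL, hexp⟩ := exists_log_secant hG hΓ hG0 hinj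
  have hpi := Real.pi_pos
  have hdiag : ∀ t ∈ Icc (0 : ℝ) 1, Complex.exp (L (t, t)) = G t :=
    fun t ht => by rw [hexp t ht t ht, secant_self]
  -- The start is leftmost and the end is rightmost, so secants from the start and secants to the
  -- end all point into the right half-plane. The two families share the chord `(0,1)`, which forces
  -- `k = m`.
  obtain ⟨k, hk⟩ := exists_im_mem_Icc_of_re_nonneg (ℓ := fun t => L (0, t))
    isPreconnected_Icc zero_mem_unit (by fun_prop) (fun t ht => by
      rw [hexp 0 zero_mem_unit t ht]
      rcases ht.1.eq_or_lt with rfl | h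
      · rw [secant_self]; exact h0.le
      · exact re_secant_nonneg hG hΓ h (hmin t ht))
  obtain ⟨m, hm⟩ := exists_im_mem_Icc_of_re_nonneg (ℓ := fun t => L (t, 1))
    isPreconnected_Icc zero_mem_unit (by fun_prop) (fun t ht => by
      rw [hexp t ht 1 one_mem_unit]
      rcases ht.2.eq_or_lt with rfl | h
      · rw [secant_self]; exact h1.le
      · exact re_secant_nonneg hG hΓ h (hmax t ht))
  have e0 := im_mem_Ioo_of_re_pos (hk 0 zero_mem_unit) (by rwa [hdiag 0 zero_mem_unit])
  have e1 := im_mem_Ioo_of_re_pos (hm 1 one_mem_unit) (by rwa [hdiag 1 one_mem_unit])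
  have c1 := hk 1 one_mem_unit
  have c2 := hm 0 zero_mem_unit
  have i1 : m ≤ k := int_le_of_mul_pi_lt (by linarith [c1.2, c2.1])
  have i2 : k ≤ m := int_le_of_mul_pi_lt (by linarith [c1.1, c2.2])
  obtain rfl := le_antisymm i1 i2
  exact ⟨fun t => L (t, t), by fun_prop, hdiag, 2 * m, by push_cast; exact e0,
    by push_cast; exact e1⟩

/-- An arc in a half-plane with both ends on the boundary line makes a half-turn. -/
lemma exists_log_deriv_of_returning {Γ G : ℝ → ℂ} (hG : Continuous G)
    (hΓ : ∀ t, HasDerivAt Γ (G t) t) (hG0 : ∀ t ∈ Icc (0 : ℝ) 1, G t ≠ 0)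
    (hinj : InjOn Γ (Icc 0 1)) (hmin : ∀ t ∈ Icc (0 : ℝ) 1, (Γ 0).re ≤ (Γ t).re)
    (hend : (Γ 1).re = (Γ 0).re) (h0 : 0 < (G 0).re) (h1 : (G 1).re < 0) :
    ∃ ℓ : ℝ → ℂ, Continuous ℓ ∧ (∀ t ∈ Icc (0 : ℝ) 1, Complex.exp (ℓ t) = G t) ∧ ∃ κ₀ κ₁ : ℤ,
      (ℓ 0).im ∈ Ioo (κ₀ * Real.pi - Real.pi / 2) (κ₀ * Real.pi + Real.pi / 2) ∧
      (ℓ 1).im ∈ Ioo (κ₁ * Real.pi - Real.pi / 2) (κ₁ * Real.pi + Real.pi / 2) ∧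
      ((Γ 0).im < (Γ 1).im → κ₁ = κ₀ + 1) ∧ ((Γ 1).im < (Γ 0).im → κ₁ = κ₀ - 1) := by
  obtain ⟨L, hL, hexp⟩ := exists_log_secant hG hΓ hG0 hinj
  have hpi := Real.pi_pos
  have hdiag : ∀ t ∈ Icc (0 : ℝ) 1, Complex.exp (L (t, t)) = G t :=
    fun t ht => by rw [hexp t ht t ht, secant_self]
  obtain ⟨k, hk⟩ := exists_im_mem_Icc_of_re_nonneg (ℓ := fun t => L (0, t))
    isPreconnected_Icc zero_mem_unit (by fun_prop) (fun t ht => by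
      rw [hexp 0 zero_mem_unit t ht]
      rcases ht.1.eq_or_lt with rfl | h
      · rw [secant_self]; exact h0.le
      · exact re_secant_nonneg hG hΓ h (hmin t ht))
  obtain ⟨m, hm⟩ := exists_im_mem_Icc_of_re_nonpos (ℓ := fun t => L (t, 1))
    isPreconnected_Icc zero_mem_unit (by fun_prop) (fun t ht => by
      rw [hexp t ht 1 one_mem_unit]
      rcases ht.2.eq_or_lt with rfl | h
      · rw [secant_self]; exact h1.le
      · exact re_secant_nonpos hG hΓ h (hend ▸ hmin t ht))
  have e0 := im_mem_Ioo_of_re_pos (hk 0 zero_mem_unit) (by rwa [hdiag 0 zero_mem_unit])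
  have e1 := im_mem_Ioo_of_re_neg (hm 1 one_mem_unit) (by rwa [hdiag 1 one_mem_unit])
  have c1 := hk 1 one_mem_unit
  have c2 := hm 0 zero_mem_unit
  -- The chord is vertical and lies both in the right half-turn `k` of secants from the start and in
  -- the left half-turn `m` of secants to the end. Pointing up it is the end common to `k` and `m =
  -- k`; pointing down it is the end common to `k` and `m = k - 1`. This decides the sense of the
  -- half-turn.
  have hchord : Complex.exp (L (0, 1)) = ((Γ 1).im - (Γ 0).im : ℝ) * Complex.I := by
    rw [hexp 0 zero_mem_unit 1 one_mem_unit]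
    have := mul_secant hG hΓ 0 1
    rw [sub_zero, Complex.ofReal_one, one_mul] at this
    rw [this]
    apply Complex.ext <;> simp [hend]
  refine ⟨fun t => L (t, t), by fun_prop, hdiag, 2 * k, 2 * m + 1, by push_cast; exact e0,
    ⟨by push_cast; linarith [e1.1], by push_cast; linarith [e1.2]⟩, fun h => ?_, fun h => ?_⟩
  · obtain ⟨n, hn⟩ := exists_im_eq_of_exp_eq_pos (sub_pos.2 h) hchord
    simp only [hn] at c1 c2
    have i1 : n ≤ k := int_le_of_mul_pi_lt (by linarith [c1.2])
    have i2 : k ≤ n := int_le_of_mul_pi_lt (by linarith [c1.1])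
    have i3 : m ≤ n := int_le_of_mul_pi_lt (by linarith [c2.1])
    have i4 : n ≤ m := int_le_of_mul_pi_lt (by linarith [c2.2])
    omega
  · obtain ⟨n, hn⟩ := exists_im_eq_of_exp_eq_neg (sub_neg.2 h) hchord
    simp only [hn] at c1 c2
    have i1 : n ≤ k := int_le_of_mul_pi_lt (by linarith [c1.2])
    have i2 : k ≤ n := int_le_of_mul_pi_lt (by linarith [c1.1])
    have i3 : m + 1 ≤ n := int_le_of_mul_pi_lt (by push_cast; linarith [c2.1])
    have i4 : n ≤ m + 1 := int_le_of_mul_pi_lt (by push_cast; linarith [c2.2])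
    omega

/-! ### Angles between lines -/

lemma exists_arg_eq_add {z : ℂ} {c β : ℝ} (h : z = c * Complex.exp (β * Complex.I)) (hc : c ≠ 0) :
    ∃ n : ℤ, Complex.arg z = β + n * Real.pi := by
  have hz := Complex.norm_mul_exp_arg_mul_I z
  have hn : ‖z‖ ≠ 0 := by
    rw [norm_ne_zero_iff, h]
    exact mul_ne_zero (by exact_mod_cast hc) (Complex.exp_ne_zero _)
  have h1 : (‖z‖ : ℂ) * Complex.exp ((Complex.arg z - β : ℝ) * Complex.I) = c := by
    rw [Complex.ofReal_sub, sub_mul, Complex.exp_sub, ← mul_div_assoc, hz,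
      div_eq_iff (Complex.exp_ne_zero _)]
    exact h
  have h2 := congrArg Complex.im h1
  rw [Complex.im_ofReal_mul, Complex.exp_ofReal_mul_I_im, Complex.ofReal_im] at h2
  obtain ⟨n, hn'⟩ := Real.sin_eq_zero_iff.1 ((mul_eq_zero.1 h2).resolve_left hn)
  exact ⟨n, by linarith⟩

lemma ccwAngle_eq {v w : ℂ} {c β : ℝ} (hv : v ≠ 0) (hc : c ≠ 0) (hβ : β ∈ Ico 0 Real.pi)
    (h : w = c * Complex.exp (β * Complex.I) * v) : ccwAngle v w = β := by
  obtain ⟨n, hn⟩ := exists_arg_eq_add (z := w / v) (by rw [h, mul_div_cancel_right₀ _ hv]) hc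
  rw [ccwAngle, toIcoMod_eq_iff]
  exact ⟨by simpa using hβ, n, by simpa using hn⟩

lemma ccwAngle_mul_right {v w : ℂ} {c : ℝ} (hc : c ≠ 0) (hv : v ≠ 0) (hw : w ≠ 0) :
    ccwAngle v (c * w) = ccwAngle v w := by
  have hz : w / v ≠ 0 := div_ne_zero hw hv
  have hn : c * ‖w / v‖ ≠ 0 := mul_ne_zero hc (norm_ne_zero_iff.2 hz)
  obtain ⟨n, hn'⟩ := exists_arg_eq_add (z := c * w / v) (c := c * ‖w / v‖)
    (β := Complex.arg (w / v)) (by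
      rw [Complex.ofReal_mul, mul_assoc, Complex.norm_mul_exp_arg_mul_I, mul_div_assoc]) hn
  rw [ccwAngle, ccwAngle, hn', ← zsmul_eq_mul, toIcoMod_add_zsmul]

lemma ccwAngle_mul_mul {v w z : ℂ} (hz : z ≠ 0) : ccwAngle (v * z) (w * z) = ccwAngle v w := by
  rw [ccwAngle, ccwAngle, mul_div_mul_right _ _ hz]

lemma exp_int_mul_pi_mul_I (n : ℤ) :
    ∃ c : ℝ, c ≠ 0 ∧ Complex.exp (n * Real.pi * Complex.I) = c := by
  refine ⟨Real.cos (n * Real.pi), ?_, ?_⟩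
  · intro h
    have h1 := Real.sin_sq_add_cos_sq (n * Real.pi)
    rw [h, Real.sin_int_mul_pi] at h1
    norm_num at h1
  · have := Complex.exp_mul_I (n * Real.pi : ℝ)
    rw [← Complex.ofReal_cos, ← Complex.ofReal_sin, Real.sin_int_mul_pi] at this
    push_cast at this ⊢
    simpa using this

/-- The angle from a direction `c e^ℓ` to the vertical. -/
lemma ccwAngle_exp_I {ℓ : ℂ} {c : ℝ} (hc : c ≠ 0) {κ : ℤ}
    (h : ℓ.im ∈ Ioo (κ * Real.pi - Real.pi / 2) (κ * Real.pi + Real.pi / 2)) :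
    ccwAngle (c * Complex.exp ℓ) Complex.I = Real.pi / 2 - ℓ.im + κ * Real.pi := by
  obtain ⟨e, he, he'⟩ := exp_int_mul_pi_mul_I κ
  have hcC : (c : ℂ) ≠ 0 := by exact_mod_cast hc
  have heC : (e : ℂ) ≠ 0 := by exact_mod_cast he
  refine ccwAngle_eq (c := (c * e * Real.exp ℓ.re)⁻¹)
    (mul_ne_zero hcC (Complex.exp_ne_zero _))
    (inv_ne_zero (mul_ne_zero (mul_ne_zero hc he) (Real.exp_pos _).ne'))
    ⟨by linarith [h.2], by linarith [h.1]⟩ ?_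
  have h1 : Complex.exp ((Real.pi / 2 - ℓ.im + κ * Real.pi : ℝ) * Complex.I) * Complex.exp ℓ =
      Complex.I * e * Real.exp ℓ.re := by
    have h2 : Complex.I * e * Real.exp ℓ.re = Complex.exp (Real.pi / 2 * Complex.I) *
        Complex.exp (κ * Real.pi * Complex.I) * Complex.exp ℓ.re := by
      rw [Complex.exp_pi_div_two_mul_I, he', Complex.ofReal_exp]
    rw [h2, ← Complex.exp_add, ← Complex.exp_add, ← Complex.exp_add]
    congr 1
    push_cast
    linear_combination -Complex.re_add_im ℓ
  have hexp : ((Real.exp ℓ.re : ℝ) : ℂ) ≠ 0 := by exact_mod_cast (Real.exp_pos _).ne'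
  rw [mul_assoc, mul_left_comm _ (c : ℂ), h1]
  push_cast
  push_cast at hexp
  field_simp

/-! ### Angles of foliations -/

lemma continuous_lineToCircle : Continuous lineToCircle := by
  have h : Continuous fun v : {v : ℂ // v ≠ 0} => (Circle.ofConjDivSelf v.1 v.2)⁻¹ := by
    refine Continuous.inv (continuous_induced_rng.2 ?_)
    change Continuous fun v : {v : ℂ // v ≠ 0} => (starRingEnd ℂ) v.1 / v.1
    exact (Complex.continuous_conj.comp continuous_subtype_val).div continuous_subtype_val
      (fun v => v.2)
  exact continuous_coinduced_dom.2 h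

lemma continuous_projectivization_mk {A : Type*} [TopologicalSpace A] {f : A → ℂ}
    (hf : Continuous f) (h0 : ∀ a, f a ≠ 0) :
    Continuous fun a => Projectivization.mk ℝ (f a) (h0 a) :=
  continuous_coinduced_rng.comp (hf.subtype_mk h0)

/-- `v / conj v` doubles arguments, which accounts for the factor `2`: angles of lines count modulo
`π`, and their doubles modulo `2π`. -/
lemma lineToCircle_mk_exp (w : ℂ) :
    lineToCircle (Projectivization.mk ℝ (Complex.exp w) (Complex.exp_ne_zero w)) =
      Circle.exp (2 * w.im) := by
  ext
  change (((Circle.ofConjDivSelf (Complex.exp w) (Complex.exp_ne_zero w))⁻¹ : Circle) : ℂ) = _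
  rw [Circle.coe_inv, Circle.coe_exp]
  change ((starRingEnd ℂ) (Complex.exp w) / Complex.exp w)⁻¹ = _
  rw [inv_div, ← Complex.exp_conj, ← Complex.exp_sub, Complex.sub_conj]

lemma exists_im_eq_of_mk_exp_eq {a b : ℂ}
    (h : Projectivization.mk ℝ (Complex.exp a) (Complex.exp_ne_zero a) =
      Projectivization.mk ℝ (Complex.exp b) (Complex.exp_ne_zero b)) :
    ∃ n : ℤ, a.im = b.im + n * Real.pi := by
  have h1 := congrArg lineToCircle h
  rw [lineToCircle_mk_exp, lineToCircle_mk_exp] at h1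
  obtain ⟨n, hn⟩ := Circle.exp_eq_exp.1 h1
  exact ⟨n, by linarith⟩

lemma mk_exp_eq_of_im_eq {a b : ℂ} {n : ℤ} (h : a.im = b.im + n * Real.pi) :
    Projectivization.mk ℝ (Complex.exp a) (Complex.exp_ne_zero a) =
      Projectivization.mk ℝ (Complex.exp b) (Complex.exp_ne_zero b) := by
  obtain ⟨c, hc, hc'⟩ := exp_int_mul_pi_mul_I n
  rw [Projectivization.mk_eq_mk_iff']
  refine ⟨c * Real.exp (a.re - b.re), ?_⟩
  rw [Complex.real_smul, Complex.ofReal_mul, ← hc', Complex.ofReal_exp, ← Complex.exp_add,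
    ← Complex.exp_add]
  congr 1
  apply Complex.ext
  · simp
  · simp [h]; ring

lemma mk_exp_of_lineToCircle_eq {ℓ : ℙ ℝ ℂ} {w : ℂ} (h : lineToCircle ℓ = Circle.exp (2 * w.im)) :
    ℓ = Projectivization.mk ℝ (Complex.exp w) (Complex.exp_ne_zero w) := by
  induction ℓ using Projectivization.ind with
  | h v hv =>
    have hv' : Projectivization.mk ℝ v hv = Projectivization.mk ℝ
        (Complex.exp (Complex.log v)) (Complex.exp_ne_zero _) := by
      congr 1
      exact (Complex.exp_log hv).symm
    rw [hv', lineToCircle_mk_exp] at h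
    obtain ⟨n, hn⟩ := Circle.exp_eq_exp.1 h
    rw [hv']
    exact mk_exp_eq_of_im_eq (n := n) (by linarith)

/-- The line at `z` that makes the angle `θ` with the circle direction. -/
noncomputable def rotatedLine (z : ℂ) (hz : z ≠ 0) (θ : ℝ) : ℙ ℝ ℂ :=
  Projectivization.mk ℝ (Complex.I * z * Complex.exp (θ * Complex.I))
    (mul_ne_zero (mul_ne_zero Complex.I_ne_zero hz) (Complex.exp_ne_zero _))

lemma rotatedLine_exp (w : ℂ) (θ : ℝ) : rotatedLine (Complex.exp w) (Complex.exp_ne_zero w) θ =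
    Projectivization.mk ℝ (Complex.exp (w + (Real.pi / 2 + θ) * Complex.I))
      (Complex.exp_ne_zero _) := by
  unfold rotatedLine
  congr 1
  rw [Complex.exp_add, add_mul, Complex.exp_add, Complex.exp_pi_div_two_mul_I]
  ring

lemma mem_rotatedLine_iff {z : ℂ} {hz : z ≠ 0} {θ : ℝ} {v : ℂ} :
    v ∈ (rotatedLine z hz θ).submodule ↔
      ∃ c : ℝ, v = c * (Complex.I * z * Complex.exp (θ * Complex.I)) := by
  rw [rotatedLine, Projectivization.submodule_mk, Submodule.mem_span_singleton]
  simp only [Complex.real_smul, eq_comm]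

lemma exp_mem_annulus_iff {w : ℂ} :
    Complex.exp w ∈ annulus ↔ 0 ≤ w.re ∧ w.re ≤ Real.log 2 := by
  change 1 ≤ ‖Complex.exp w‖ ∧ ‖Complex.exp w‖ ≤ 2 ↔ _
  rw [Complex.norm_exp, Real.one_le_exp_iff, Real.le_log_iff_exp_le (by norm_num)]

/-! ### The angle of a foliation in logarithmic coordinates. -/

/-- The retraction of the plane to the strip over the annulus. -/
noncomputable def stripClamp (w : ℂ) : ℂ :=
  (max 0 (min (Real.log 2) w.re) : ℝ) + (w.im : ℂ) * Complex.I

lemma continuous_stripClamp : Continuous stripClamp := by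
  unfold stripClamp
  fun_prop

lemma exp_stripClamp_mem (w : ℂ) : Complex.exp (stripClamp w) ∈ annulus := by
  have := Real.log_nonneg (show (1 : ℝ) ≤ 2 by norm_num)
  rw [exp_mem_annulus_iff]
  simp [stripClamp, this]

lemma stripClamp_of_mem {w : ℂ} (hw : Complex.exp w ∈ annulus) : stripClamp w = w := by
  rw [exp_mem_annulus_iff] at hw
  rw [stripClamp, min_eq_right hw.2, max_eq_right hw.1, Complex.re_add_im]

lemma exp_stripClamp_add (w : ℂ) : Complex.exp (stripClamp (w + 2 * Real.pi * Complex.I)) =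
    Complex.exp (stripClamp w) := by
  have : stripClamp (w + 2 * Real.pi * Complex.I) = stripClamp w + 2 * Real.pi * Complex.I := by
    simp [stripClamp]
    ring
  rw [this, Complex.exp_add, Complex.exp_two_pi_mul_I, mul_one]

/-- A family of foliations has a continuous angle relative to the circle direction, in
logarithmic coordinates; its increment over one turn does not depend on the parameter. -/
lemma exists_angle_family {K : ℝ × annulus → ℙ ℝ ℂ} (hK : Continuous K) :
    ∃ (ψ : ℝ × ℂ → ℝ) (d : ℤ), Continuous ψ ∧
      (∀ s w (hw : Complex.exp w ∈ annulus),
        K (s, ⟨Complex.exp w, hw⟩) = rotatedLine (Complex.exp w) (Complex.exp_ne_zero w) (ψ (s, w))) ∧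
      ∀ s w, ψ (s, w + 2 * Real.pi * Complex.I) = ψ (s, w) + d * Real.pi := by
  have hpi := Real.pi_pos
  have hc : Continuous fun p : ℝ × ℂ => (⟨Complex.exp (stripClamp p.2), exp_stripClamp_mem p.2⟩ :
      annulus) :=
    (Complex.continuous_exp.comp (continuous_stripClamp.comp continuous_snd)).subtype_mk _
  obtain ⟨φ, hφ, hexp⟩ := exists_continuous_angle (A := ℝ × ℂ)
    (f := fun p => lineToCircle (K (p.1, ⟨Complex.exp (stripClamp p.2), exp_stripClamp_mem p.2⟩)))
    (continuous_lineToCircle.comp (hK.comp (continuous_fst.prodMk hc)))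
  have hstep : ∀ p : ℝ × ℂ, ∃ n : ℤ,
      φ (p.1, p.2 + 2 * Real.pi * Complex.I) - φ p = 0 + n * (2 * Real.pi) := by
    rintro ⟨s, w⟩
    have : Circle.exp (φ (s, w + 2 * Real.pi * Complex.I)) = Circle.exp (φ (s, w)) := by
      rw [hexp, hexp]
      simp only [exp_stripClamp_add]
    obtain ⟨n, hn⟩ := Circle.exp_eq_exp.1 this
    exact ⟨n, by simp only; linarith⟩
  obtain ⟨n, hn⟩ := hstep (0, 0)
  -- `φ / 2` is the argument of the line in the plane, and `Im w + π/2` is the argument of the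
  -- circle direction `i exp w`. The latter gains `2π` per turn, so `n π` drops to `(n - 2) π`.
  refine ⟨fun p => φ p / 2 - p.2.im - Real.pi / 2, n - 2, by fun_prop, ?_, ?_⟩
  · intro s w hw
    rw [rotatedLine_exp]
    apply mk_exp_of_lineToCircle_eq
    have h1 := hexp (s, w)
    simp only [stripClamp_of_mem hw] at h1
    rw [← h1]
    congr 1
    simp
    ring
  · intro s w
    have h1 := eq_of_mem_int_multiples (A := ℝ × ℂ) (S := univ) isPreconnected_univ
      (f := fun p => φ (p.1, p.2 + 2 * Real.pi * Complex.I) - φ p) (by fun_prop)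
      (p := 2 * Real.pi) (by positivity) 0 (fun p _ => hstep p) (x := (s, w)) (y := (0, 0))
      trivial trivial
    simp only at h1 hn
    rw [hn] at h1
    simp
    linarith

/-- `ψ` is an angle of the foliation `η` relative to the circle direction, as a function of
`log z`, with increment `d π` over one turn. -/
structure IsAngle (η : Foliation) (ψ : ℂ → ℝ) (d : ℤ) : Prop where
  continuous : Continuous ψ
  spec : ∀ w (hw : Complex.exp w ∈ annulus),
    η ⟨Complex.exp w, hw⟩ = rotatedLine (Complex.exp w) (Complex.exp_ne_zero w) (ψ w)
  period : ∀ w, ψ (w + 2 * Real.pi * Complex.I) = ψ w + d * Real.pi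

lemma exists_isAngle (η : Foliation) : ∃ ψ d, IsAngle η ψ d := by
  obtain ⟨ψ, d, hψ, hs, hp⟩ := exists_angle_family (K := fun p => η p.2) (by fun_prop)
  exact ⟨fun w => ψ (0, w), d, by fun_prop, hs 0, hp 0⟩

lemma ofReal_mul_I_exp_mem (t : ℝ) : Complex.exp (t * Complex.I) ∈ annulus := by
  rw [exp_mem_annulus_iff]
  simp [Real.log_nonneg]

/-- Two angles of one line field differ by a multiple of `π`, which is constant along the inner
circle, so their increments over a turn agree. -/
lemma IsAngle.unique {η : Foliation} {ψ ψ' : ℂ → ℝ} {d d' : ℤ} (h : IsAngle η ψ d)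
    (h' : IsAngle η ψ' d') : d = d' := by
  have hc := h.continuous
  have hc' := h'.continuous
  have key : ∀ t : ℝ, ∃ n : ℤ, ψ (t * Complex.I) - ψ' (t * Complex.I) = 0 + n * Real.pi := by
    intro t
    have e := (h.spec _ (ofReal_mul_I_exp_mem t)).symm.trans (h'.spec _ (ofReal_mul_I_exp_mem t))
    rw [rotatedLine_exp, rotatedLine_exp] at e
    obtain ⟨n, hn⟩ := exists_im_eq_of_mk_exp_eq e
    refine ⟨n, ?_⟩
    simp at hn
    linarith
  have h1 := eq_of_mem_int_multiples (A := ℝ) (S := univ) isPreconnected_univ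
    (f := fun t => ψ (t * Complex.I) - ψ' (t * Complex.I)) (by fun_prop) Real.pi_pos 0
    (fun t _ => key t) (x := 2 * Real.pi) (y := 0) trivial trivial
  have h2 := h.period 0
  have h3 := h'.period 0
  simp only [Complex.ofReal_zero, zero_mul, zero_add] at h1 h2 h3
  push_cast at h1
  rw [h2, h3] at h1
  have : (d : ℝ) = d' := mul_right_cancel₀ Real.pi_pos.ne' (by linarith)
  exact_mod_cast this

lemma IsAngle.add_int_mul {η : Foliation} {ψ : ℂ → ℝ} (h : IsAngle η ψ 0) (w : ℂ) (n : ℤ) :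
    ψ (w + n * (2 * Real.pi * Complex.I)) = ψ w := by
  have hp : Function.Periodic ψ (2 * Real.pi * Complex.I) := fun w => by
    rw [h.period]; simp
  have := hp.int_mul n
  exact this w

lemma IsAngle.eq_of_exp_eq {η : Foliation} {ψ : ℂ → ℝ} (h : IsAngle η ψ 0) {w w' : ℂ}
    (hw : Complex.exp w = Complex.exp w') : ψ w = ψ w' := by
  obtain ⟨n, rfl⟩ := Complex.exp_eq_exp_iff_exists_int.1 hw
  exact h.add_int_mul w' n

/-- A foliation of degree `0` has a continuous angle on the annulus. -/
lemma IsAngle.exists_global {η : Foliation} {ψ : ℂ → ℝ} (h : IsAngle η ψ 0) :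
    ∃ Ψ : ℂ → ℝ, ContinuousOn Ψ annulus ∧
      ∀ z (hz : z ∈ annulus), η ⟨z, hz⟩ = rotatedLine z (ne_zero_of_mem_annulus hz) (Ψ z) := by
  refine ⟨fun z => ψ (Complex.log z), ?_, ?_⟩
  · intro z hz
    have hz0 := ne_zero_of_mem_annulus hz
    -- The jump of the principal logarithm is invisible to the periodic `ψ`. Near `z` the branch
    -- `log (u / z) + log z` can be used instead, and it is continuous because `u / z` is near `1`.
    have heq : (fun z => ψ (Complex.log z)) =ᶠ[𝓝 z]
        fun u => ψ (Complex.log (u / z) + Complex.log z) := by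
      filter_upwards [isOpen_ne.mem_nhds hz0] with u hu
      apply h.eq_of_exp_eq
      rw [Complex.exp_add, Complex.exp_log hu, Complex.exp_log hz0,
        Complex.exp_log (div_ne_zero hu hz0), div_mul_cancel₀ _ hz0]
    have hc : ContinuousAt (fun u => ψ (Complex.log (u / z) + Complex.log z)) z := by
      refine h.continuous.continuousAt.comp (ContinuousAt.add ?_ continuousAt_const)
      refine ContinuousAt.clog (continuousAt_id.div_const z) ?_
      simp [hz0]
    exact (hc.congr heq.symm).continuousWithinAt
  · intro z hz
    have hz0 := ne_zero_of_mem_annulus hz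
    have hl := Complex.exp_log hz0
    have := h.spec (Complex.log z) (by rwa [hl])
    simp only [hl] at this
    exact this

/-! ### The homotopy class and the degree -/

/-- The foliation by concentric circles. -/
noncomputable def circleFoliation : Foliation where
  toFun z := rotatedLine z (ne_zero_of_mem_annulus z.2) 0
  continuous_toFun := continuous_projectivization_mk (by fun_prop) _

lemma isAngle_circleFoliation : IsAngle circleFoliation (fun _ => 0) 0 :=
  ⟨continuous_const, fun _ _ => rfl, by simp⟩

/-- The increment is shared by all members of a homotopy, and it is `0` for concentric circles.
Conversely, for `d = 0` the angle is a real function on the annulus and is contracted linearly to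
`0`. -/
lemma IsAngle.toClass_eq_iff {η : Foliation} {ψ : ℂ → ℝ} {d : ℤ} (h : IsAngle η ψ d) :
    η.toClass = circleFoliation.toClass ↔ d = 0 := by
  have hq : η.toClass = circleFoliation.toClass ↔ ContinuousMap.Homotopic η circleFoliation :=
    Quotient.eq
  rw [hq]
  constructor
  · rintro ⟨H⟩
    obtain ⟨φ, e, hφ, hs, hp⟩ := exists_angle_family
      (K := fun p => H (projIcc 0 1 zero_le_one p.1, p.2))
      (H.continuous.comp ((continuous_projIcc.comp continuous_fst).prodMk continuous_snd))
    have h0 : IsAngle η (fun w => φ (0, w)) e :=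
      ⟨by fun_prop, fun w hw => by rw [← hs 0 w hw]; simp, hp 0⟩
    have h1 : IsAngle circleFoliation (fun w => φ (1, w)) e :=
      ⟨by fun_prop, fun w hw => by rw [← hs 1 w hw]; simp, hp 1⟩
    rw [h.unique h0, h1.unique isAngle_circleFoliation]
  · rintro rfl
    obtain ⟨Ψ, hΨ, hη⟩ := h.exists_global
    have hΨ' : Continuous fun z : annulus => Ψ z := continuousOn_iff_continuous_domRestrict.1 hΨ
    have hcont : Continuous fun p : unitInterval × annulus => Complex.I * (p.2 : ℂ) *
        Complex.exp (((1 - (p.1 : ℝ)) * Ψ p.2 : ℝ) * Complex.I) := by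
      have h1 : Continuous fun p : unitInterval × annulus => (1 - (p.1 : ℝ)) * Ψ p.2 :=
        (by fun_prop : Continuous fun p : unitInterval × annulus => 1 - (p.1 : ℝ)).mul
          (hΨ'.comp continuous_snd)
      exact (by fun_prop : Continuous fun p : unitInterval × annulus =>
        Complex.I * (p.2 : ℂ)).mul
          (((Complex.continuous_ofReal.comp h1).mul continuous_const).cexp)
    refine ⟨{
      toFun := fun p => rotatedLine p.2 (ne_zero_of_mem_annulus p.2.2) ((1 - (p.1 : ℝ)) * Ψ p.2)
      continuous_toFun := continuous_projectivization_mk hcont _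
      map_zero_left := fun z => ?_
      map_one_left := fun z => ?_ }⟩
    · simp [hη z.1 z.2]
    · simp only [Icc.coe_one, sub_self, zero_mul]
      rfl

lemma HasDegree.unique {f : Circle → Circle} {d d' : ℤ} (h : HasDegree f d)
    (h' : HasDegree f d') : d = d' := by
  obtain ⟨F, hF, hf, hp⟩ := h
  obtain ⟨F', hF', hf', hp'⟩ := h'
  have hpi := Real.pi_pos
  have h1 := eq_of_mem_int_multiples (A := ℝ) (S := univ) isPreconnected_univ
    (f := fun t => F t - F' t) (by fun_prop) (p := 2 * Real.pi) (by positivity) 0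
    (fun t _ => by
      obtain ⟨n, hn⟩ := Circle.exp_eq_exp.1 ((hf t).symm.trans (hf' t))
      exact ⟨n, by linarith⟩) (x := 0 + 2 * Real.pi) (y := 0) trivial trivial
  simp only [hp, hp'] at h1
  have : (d : ℝ) = d' := mul_right_cancel₀ (mul_pos two_pos hpi).ne' (by linarith)
  exact_mod_cast this

/-- In the frame `i z` the line is spanned by `e^{iψ}`, so the circle map lifts to `2ψ`, and the
increment `d π` becomes `2π d`. -/
lemma IsAngle.hasDegree {η : Foliation} {ψ : ℂ → ℝ} {d : ℤ} (h : IsAngle η ψ d) :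
    HasDegree η.circleMap d := by
  have hc := h.continuous
  refine ⟨fun t => 2 * ψ (t * Complex.I), by fun_prop, fun t => ?_, fun t => ?_⟩
  · have hi : innerCircle (Circle.exp t) = ⟨_, ofReal_mul_I_exp_mem t⟩ :=
      Subtype.ext (Circle.coe_exp t)
    have h0 := Complex.exp_ne_zero (t * Complex.I)
    rw [Foliation.circleMap, hi, h.spec]
    simp only [trivialization, rotatedLine, Projectivization.map_mk]
    have hl := lineToCircle_mk_exp (ψ (t * Complex.I) * Complex.I)
    rw [show ((ψ (t * Complex.I) * Complex.I : ℂ)).im = ψ (t * Complex.I) by simp] at hl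
    rw [← hl]
    congr 2
    simp only [frameCoord, LinearMap.mulLeft_apply]
    field_simp
  · have := h.period (t * Complex.I)
    have e : ((t + 2 * Real.pi : ℝ) : ℂ) * Complex.I = t * Complex.I + 2 * Real.pi * Complex.I := by
      push_cast; ring
    simp only [e, this]
    ring

/-! ### Gradings relative to the circle direction -/

lemma exists_im_eq_of_exp_eq_mul_I {z : ℂ} {y : ℝ} (h : Complex.exp z = y * Complex.I) :
    ∃ m : ℤ, z.im = Real.pi / 2 + m * Real.pi := by
  have hy : y ≠ 0 := by
    rintro rfl
    simp at h
  rcases hy.lt_or_gt with hy | hy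
  · obtain ⟨m, hm⟩ := exists_im_eq_of_exp_eq_neg hy h
    exact ⟨2 * m - 1, by push_cast; linarith⟩
  · obtain ⟨m, hm⟩ := exists_im_eq_of_exp_eq_pos hy h
    exact ⟨2 * m, by push_cast; linarith⟩

/-- For a foliation with angle `Ψ`, a grading of a curve with direction angle `θ` is
`Ψ - θ` up to a constant. -/
lemma IsGrading.sub_add_eq {η : Foliation} {Ψ : ℂ → ℝ} (hΨ : ContinuousOn Ψ annulus)
    (hη : ∀ z (hz : z ∈ annulus), η ⟨z, hz⟩ = rotatedLine z (ne_zero_of_mem_annulus hz) (Ψ z))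
    {γ : ℝ → ℂ} {a θ : ℝ → ℝ} (hγ : ContinuousOn γ (Icc 0 1))
    (hmem : ∀ t ∈ Icc (0 : ℝ) 1, γ t ∈ annulus) (ha : IsGrading η γ a)
    (hθ : ContinuousOn θ (Icc 0 1))
    (hv : ∀ t ∈ Icc (0 : ℝ) 1, ∃ c : ℝ, c ≠ 0 ∧
      velocity γ t = c * Complex.exp (θ t * Complex.I) * γ t) {t t' : ℝ}
    (ht : t ∈ Icc (0 : ℝ) 1) (ht' : t' ∈ Icc (0 : ℝ) 1) :
    a t - Ψ (γ t) + θ t = a t' - Ψ (γ t') + θ t' := by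
  refine eq_of_mem_int_multiples isPreconnected_Icc (f := fun t => a t - Ψ (γ t) + θ t)
    ((ha.1.sub (hΨ.comp hγ hmem)).add hθ) Real.pi_pos (Real.pi / 2) (fun t ht => ?_) ht ht'
  obtain ⟨c, hc, hvc⟩ := hv t ht
  have hmem' := ha.2 t ht (hmem t ht)
  rw [hη, mem_rotatedLine_iff, hvc] at hmem'
  obtain ⟨e, he⟩ := hmem'
  have h0 := ne_zero_of_mem_annulus (hmem t ht)
  have hcC : (c : ℂ) ≠ 0 := by exact_mod_cast hc
  -- Rotating `e^{iθ} γ` by `a` must give the line of `i γ e^{iΨ}`. Here `θ` is measured from the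
  -- radial direction and `Ψ` from the circle direction, hence the offset `π/2`, and everything is
  -- modulo `π`.
  obtain ⟨m, hm⟩ := exists_im_eq_of_exp_eq_mul_I (z := (a t - Ψ (γ t) + θ t : ℝ) * Complex.I)
    (y := e / c) (by
      have h1 : Complex.exp ((a t - Ψ (γ t) + θ t : ℝ) * Complex.I) =
          Complex.exp (a t * Complex.I) * Complex.exp (θ t * Complex.I) /
            Complex.exp (Ψ (γ t) * Complex.I) := by
        rw [← Complex.exp_add, ← Complex.exp_sub]
        congr 1
        push_cast
        ring
      rw [h1, div_eq_iff (Complex.exp_ne_zero _)]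
      push_cast
      have h2 : (Complex.exp (a t * Complex.I) * Complex.exp (θ t * Complex.I)) * (c * γ t) =
          (e / c * Complex.I * Complex.exp (Ψ (γ t) * Complex.I)) * (c * γ t) := by
        have hdc : (e / c : ℂ) * c = e := div_mul_cancel₀ _ hcC
        linear_combination he - Complex.I * Complex.exp (Ψ (γ t) * Complex.I) * γ t * hdc
      exact mul_right_cancel₀ (mul_ne_zero hcC h0) h2)
  exact ⟨m, by simpa using hm⟩

/-! ### Curves that are straight in logarithmic coordinates -/

/-- The curve with the logarithm `A + B u`. -/
noncomputable def spiral (A B : ℂ) (u : ℝ) : ℂ := Complex.exp (A + B * u)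

lemma contDiff_spiral (A B : ℂ) : ContDiff ℝ ∞ (spiral A B) :=
  Complex.contDiff_exp.comp (contDiff_const.add (contDiff_const.mul Complex.ofRealCLM.contDiff))

lemma hasDerivAt_spiral (A B : ℂ) (u : ℝ) : HasDerivAt (spiral A B) (B * spiral A B u) u := by
  have h : HasDerivAt (fun u : ℝ => A + B * (u : ℂ)) B u := by
    simpa using ((Complex.ofRealCLM.hasDerivAt (x := u)).const_mul B).const_add A
  have := h.cexp
  rwa [mul_comm] at this

lemma velocity_spiral (A B : ℂ) {u : ℝ} (hu : u ∈ Icc (0 : ℝ) 1) :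
    velocity (spiral A B) u = B * spiral A B u :=
  (hasDerivAt_spiral A B u).hasDerivWithinAt.derivWithin (uniqueDiffOn_Icc zero_lt_one u hu)

lemma spiral_ne_zero (A B : ℂ) (u : ℝ) : spiral A B u ≠ 0 := Complex.exp_ne_zero _

lemma isImmersedCurve_spiral {A B : ℂ} (hB : B ≠ 0)
    (h : ∀ u ∈ Icc (0 : ℝ) 1, 0 ≤ (A + B * u).re ∧ (A + B * u).re ≤ Real.log 2) :
    IsImmersedCurve (spiral A B) where
  smooth := (contDiff_spiral A B).contDiffOn
  mem u hu := exp_mem_annulus_iff.2 (h u hu)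
  immersed u hu := by
    rw [velocity_spiral A B hu]
    exact mul_ne_zero hB (spiral_ne_zero A B u)

/-- A spiral makes the constant angle `arg B` with the radial direction. Evaluating `ψ` along the
lift rather than on the annulus makes the formula available for every `d`. -/
lemma IsAngle.isGrading_spiral {η : Foliation} {ψ : ℂ → ℝ} {d : ℤ} (h : IsAngle η ψ d)
    (A B : ℂ) :
    IsGrading η (spiral A B) (fun u => ψ (A + B * u) + (Real.pi / 2 - Complex.arg B)) := by
  have hc := h.continuous
  refine ⟨by fun_prop, fun u hu hmem => ?_⟩
  have hspec := h.spec (A + B * u) hmem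
  change _ ∈ (η ⟨Complex.exp (A + B * u), hmem⟩).submodule
  rw [hspec, mem_rotatedLine_iff, velocity_spiral A B hu]
  refine ⟨‖B‖, ?_⟩
  have h1 : Complex.exp ((ψ (A + B * u) + (Real.pi / 2 - Complex.arg B) : ℝ) * Complex.I) * B =
      ‖B‖ * Complex.I * Complex.exp (ψ (A + B * u) * Complex.I) := by
    generalize ψ (A + B * u) = q
    calc Complex.exp ((q + (Real.pi / 2 - Complex.arg B) : ℝ) * Complex.I) * B
        = Complex.exp ((q + (Real.pi / 2 - Complex.arg B) : ℝ) * Complex.I) *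
          (‖B‖ * Complex.exp (Complex.arg B * Complex.I)) := by
          rw [Complex.norm_mul_exp_arg_mul_I]
      _ = ‖B‖ * (Complex.exp (Real.pi / 2 * Complex.I) * Complex.exp (q * Complex.I)) := by
          rw [mul_left_comm, ← Complex.exp_add, ← Complex.exp_add]
          congr 2
          push_cast
          ring
      _ = ‖B‖ * Complex.I * Complex.exp (q * Complex.I) := by
          rw [Complex.exp_pi_div_two_mul_I, mul_assoc]
  rw [← mul_assoc, h1, spiral]
  ring

/-! ### Closed curves -/

/-- A logarithm of the homotopy has an increment over the closed curve that is independent of the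
stage `s`. It would be `2π` at the circle and `0` at the constant curve. -/
lemma not_isNullhomotopic_circle : ¬ IsNullhomotopic (spiral 0 (2 * Real.pi * Complex.I)) := by
  rintro ⟨H, hH, hmem, h0, hper, h1⟩
  have hpi := Real.pi_pos
  have hcl := continuous_clamp
  obtain ⟨L, hL, hexp⟩ := exists_continuous_log (A := ℝ × ℝ)
    (f := fun p => H (clamp p.1, clamp p.2))
    (hH.comp_continuous (by fun_prop) fun p => ⟨clamp_mem _, clamp_mem _⟩)
    (fun p => ne_zero_of_mem_annulus (hmem _ (clamp_mem _) _ (clamp_mem _)))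
  have hint : ∀ {z w : ℂ}, Complex.exp z = Complex.exp w →
      ∃ n : ℤ, z.im - w.im = 0 + n * (2 * Real.pi) := by
    intro z w h
    obtain ⟨n, hn⟩ := Complex.exp_eq_exp_iff_exists_int.1 h
    refine ⟨n, ?_⟩
    rw [hn]
    simp
  have hp2 : 0 < 2 * Real.pi := by positivity
  have c0 := clamp_of_mem zero_mem_unit
  have c1 := clamp_of_mem one_mem_unit
  have e1 := eq_of_mem_int_multiples (isPreconnected_Icc (a := (0 : ℝ)) (b := 1))
    (f := fun s => (L (s, 1)).im - (L (s, 0)).im) (by fun_prop) hp2 0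
    (fun s _ => hint (by rw [hexp, hexp]; simp only [c0, c1]; exact (hper _ (clamp_mem s)).symm))
    zero_mem_unit one_mem_unit
  have e2 := eq_of_mem_int_multiples (isPreconnected_Icc (a := (0 : ℝ)) (b := 1))
    (f := fun t => (L (1, t)).im - (L (1, 0)).im) (by fun_prop) hp2 0
    (fun t _ => hint (by
      rw [hexp, hexp]; simp only [c0, c1]; exact h1 _ (clamp_mem t)))
    zero_mem_unit one_mem_unit
  have e3 := eq_of_mem_int_multiples (isPreconnected_Icc (a := (0 : ℝ)) (b := 1))
    (f := fun t => (L (0, t)).im - ((2 * Real.pi * Complex.I : ℂ) * (t : ℂ)).im) (by fun_prop) hp2 0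
    (fun t ht => hint (by
      rw [hexp]; simp only [c0, clamp_of_mem ht]; rw [h0 t ht, spiral, zero_add]))
    zero_mem_unit one_mem_unit
  simp at e1 e2 e3
  linarith

lemma isUnobstructedClosedCurve_circle :
    IsUnobstructedClosedCurve (spiral 0 (2 * Real.pi * Complex.I)) where
  smooth := contDiff_spiral _ _
  periodic u := by
    have : (0 : ℂ) + 2 * Real.pi * Complex.I * ((u + 1 : ℝ) : ℂ) =
        0 + 2 * Real.pi * Complex.I * u + 2 * Real.pi * Complex.I := by push_cast; ring
    rw [spiral, this, Complex.exp_add, Complex.exp_two_pi_mul_I, mul_one, spiral]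
  mem u := by
    rw [spiral, exp_mem_annulus_iff]
    simp [Real.log_nonneg]
  immersed u := by
    rw [(hasDerivAt_spiral _ _ u).deriv]
    exact mul_ne_zero Complex.two_pi_I_ne_zero (spiral_ne_zero _ _ _)
  injOn := by
    intro a ha b hb hab
    obtain ⟨n, hn⟩ := Complex.exp_eq_exp_iff_exists_int.1 hab
    have h1 : (a : ℂ) = b + n := mul_left_cancel₀ Complex.two_pi_I_ne_zero
      (by linear_combination hn)
    have h2 : a = b + n := by exact_mod_cast h1
    have h3 : n < 1 := by exact_mod_cast (by linarith [ha.2, hb.1] : (n : ℝ) < 1)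
    have h4 : -1 < n := by exact_mod_cast (by linarith [ha.1, hb.2] : (-1 : ℝ) < n)
    obtain rfl : n = 0 := by omega
    simpa using h2
  not_nullhomotopic := not_isNullhomotopic_circle

/-- The inner circle is the test curve: its grading is `ψ` up to a constant and changes by `d π`. -/
lemma IsAngle.eq_zero_of_windsTrivially {η : Foliation} {ψ : ℂ → ℝ} {d : ℤ} (h : IsAngle η ψ d)
    (hw : WindsTrivially η) : d = 0 := by
  have h1 := hw _ isUnobstructedClosedCurve_circle _ (h.isGrading_spiral 0 _)
  have hpi := Real.pi_pos.ne'
  have h2 := h.period 0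
  rw [div_eq_zero_iff, or_iff_left hpi] at h1
  simp only [Complex.ofReal_zero, Complex.ofReal_one, mul_zero, mul_one, add_zero, zero_add]
    at h1 h2
  have : (d : ℝ) * Real.pi = 0 := by linarith
  exact_mod_cast (mul_eq_zero.1 this).resolve_right hpi

/-- An unobstructed closed curve lifts to an injective curve with a translation symmetry. -/
lemma IsUnobstructedClosedCurve.exists_lift {γ : ℝ → ℂ} (h : IsUnobstructedClosedCurve γ) :
    ∃ (Γ G : ℝ → ℂ) (c : ℂ), Continuous G ∧ (∀ t, HasDerivAt Γ (G t) t) ∧ (∀ t, G t ≠ 0) ∧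
      Function.Injective Γ ∧ (∀ t, Γ (t + 1) = Γ t + c) ∧ ∀ t, deriv γ t = G t * γ t := by
  have h0 : ∀ t, γ t ≠ 0 := fun t => ne_zero_of_mem_annulus (h.mem t)
  have hG : Continuous fun t => deriv γ t / γ t :=
    (h.smooth.continuous_deriv (by norm_num)).div h.smooth.continuous h0
  have hGγ : ∀ t, deriv γ t / γ t * γ t = deriv γ t := fun t => div_mul_cancel₀ _ (h0 t)
  obtain ⟨Γ, hΓ, -, hexp⟩ := exists_primitive_exp_eq (K := univ) convex_univ trivial (X := γ) hG
    (fun t _ => by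
      rw [hGγ]
      exact ((h.smooth.differentiable (by norm_num)) t).hasDerivAt.hasDerivWithinAt)
    (Complex.exp_log (h0 0))
  have hΓc : Continuous Γ := continuous_iff_continuousAt.2 fun t => (hΓ t).continuousAt
  have hper : ∀ t, Γ (t + 1) - Γ t = Γ (0 + 1) - Γ 0 := by
    intro t
    refine is_const_of_deriv_eq_zero (f := fun t => Γ (t + 1) - Γ t)
      (fun t => (((hΓ (t + 1)).comp_add_const t 1).sub (hΓ t)).differentiableAt) (fun t => ?_) t 0
    have hd : deriv γ (t + 1) = deriv γ t := by
      rw [← deriv_comp_add_const]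
      congr 1
      exact funext h.periodic
    have := (((hΓ (t + 1)).comp_add_const t 1).sub (hΓ t)).deriv
    rw [hd, h.periodic t, sub_self] at this
    exact this
  set c := Γ (0 + 1) - Γ 0 with hc
  have hper' : ∀ t, Γ (t + 1) = Γ t + c := fun t => by rw [← hper t]; ring
  -- A lift that closed up could be contracted linearly within the convex strip, giving a
  -- null-homotopy.
  have hc0 : c ≠ 0 := by
    intro hc0
    refine h.not_nullhomotopic ⟨fun p => Complex.exp ((1 - p.1 : ℝ) * Γ p.2 + (p.1 : ℝ) * Γ 0),
      by fun_prop, fun s hs t _ => ?_, fun t _ => ?_, fun s _ => ?_, fun t _ => ?_⟩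
    · have hb : ∀ t, 0 ≤ (Γ t).re ∧ (Γ t).re ≤ Real.log 2 := fun t => by
        rw [← exp_mem_annulus_iff, hexp t trivial]
        exact h.mem t
      rw [exp_mem_annulus_iff]
      simp only [Complex.add_re, Complex.re_ofReal_mul]
      have hs1 := hs.1
      have hs2 := sub_nonneg.2 hs.2
      constructor
      · have := mul_nonneg hs2 (hb t).1
        have := mul_nonneg hs1 (hb 0).1
        linarith
      · have := mul_le_mul_of_nonneg_left (hb t).2 hs2
        have := mul_le_mul_of_nonneg_left (hb 0).2 hs1
        linarith
    · simp [hexp]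
    · have := hper' 0
      rw [hc0, zero_add, add_zero] at this
      simp only [this]
    · simp
  refine ⟨Γ, _, c, hG, hΓ, fun t => div_ne_zero (h.immersed t) (h0 t), ?_, hper',
    fun t => (hGγ t).symm⟩
  intro a b hab
  have hfr : ∀ t, γ (Int.fract t) = γ t := fun t => by
    have := h.periodic.sub_int_mul_eq (x := t) ⌊t⌋
    rwa [mul_one] at this
  have h1 : Int.fract a = Int.fract b := by
    refine h.injOn ⟨Int.fract_nonneg a, Int.fract_lt_one a⟩
      ⟨Int.fract_nonneg b, Int.fract_lt_one b⟩ ?_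
    rw [hfr, hfr, ← hexp a trivial, ← hexp b trivial, hab]
  obtain ⟨n, hn⟩ := Int.fract_eq_fract.1 h1
  -- Equal lifts have parameters that differ by an integer. Since `Γ t - t c` is periodic, `Γ a = Γ
  -- b` gives `a c = b c`.
  have hq : ∀ t, Γ (t + 1) - (t + 1 : ℝ) * c = Γ t - (t : ℝ) * c := fun t => by
    rw [hper']; push_cast; ring
  have hq' : Function.Periodic (fun t : ℝ => Γ t - (t : ℝ) * c) 1 := hq
  have h2 := hq'.int_mul n b
  simp only [mul_one] at h2
  rw [show b + (n : ℝ) = a by linarith, hab] at h2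
  have h3 : (a : ℂ) = b := mul_right_cancel₀ hc0 (by linear_combination -h2)
  exact_mod_cast h3

/-- The grading is `Ψ ∘ γ` minus the direction angle, up to a constant. The first closes up because
`Ψ` is single-valued, the second because of the translation symmetry of the lift. -/
lemma IsAngle.windsTrivially {η : Foliation} {ψ : ℂ → ℝ} (h : IsAngle η ψ 0) :
    WindsTrivially η := by
  intro γ hγ a ha
  obtain ⟨Ψ, hΨ, hη⟩ := h.exists_global
  obtain ⟨Γ, G, c, hG, hΓ, hG0, hinj, hper, hGγ⟩ := hγ.exists_lift
  obtain ⟨ℓ, hℓ, hexp, hend⟩ := exists_log_deriv_eq_of_translation hG hΓ hG0 hinj hper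
  have h1 := ha.sub_add_eq hΨ hη hγ.smooth.continuous.continuousOn (fun t _ => hγ.mem t)
    (θ := fun t => (ℓ t).im) (by fun_prop) (fun t ht => ⟨Real.exp (ℓ t).re, (Real.exp_pos _).ne', by
      have hv : velocity γ t = deriv γ t :=
        ((hγ.smooth.differentiable (by norm_num)) t).derivWithin
          (uniqueDiffOn_Icc zero_lt_one t ht)
      rw [hv, hGγ, ← hexp, Complex.ofReal_exp, ← Complex.exp_add, Complex.re_add_im]⟩)
    zero_mem_unit one_mem_unit
  have h2 : γ 1 = γ 0 := by simpa using hγ.periodic 0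
  rw [h2] at h1
  rw [div_eq_zero_iff]
  left
  linarith

/-! ### Markings -/

lemma IsCircleMarking.norm_eq {r : ℝ} (hr : 0 ≤ r) {M : Set ℂ} (h : IsCircleMarking r M) {z : ℂ}
    (hz : z ∈ M) : ‖z‖ = r := by
  rcases h with rfl | ⟨n, a, b, -, -, -, -, rfl⟩
  · exact hz
  · obtain ⟨i, θ, -, rfl⟩ := hz
    rw [norm_mul, Complex.norm_exp_ofReal_mul_I, mul_one, Complex.norm_real, Real.norm_of_nonneg hr]

lemma IsCircleMarking.exists_interval {r : ℝ} (hr : 0 ≤ r) {M : Set ℂ} (h : IsCircleMarking r M) :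
    ∃ p δ : ℝ, 0 < δ ∧ ∀ θ, |θ - p| < δ → (r : ℂ) * Complex.exp (θ * Complex.I) ∈ M := by
  rcases h with rfl | ⟨n, a, b, hn, hab, -, -, rfl⟩
  · refine ⟨0, 1, one_pos, fun θ _ => ?_⟩
    rw [mem_ofPred_eq, norm_mul, Complex.norm_exp_ofReal_mul_I, mul_one, Complex.norm_real,
      Real.norm_of_nonneg hr]
  · have hi := hab ⟨0, hn⟩
    refine ⟨(a ⟨0, hn⟩ + b ⟨0, hn⟩) / 2, (b ⟨0, hn⟩ - a ⟨0, hn⟩) / 2, by linarith, fun θ hθ => ?_⟩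
    rw [abs_lt] at hθ
    exact ⟨⟨0, hn⟩, θ, ⟨by linarith [hθ.1], by linarith [hθ.2]⟩, rfl⟩

lemma IsMarking.norm_eq {M : Set ℂ} (h : IsMarking M) {z : ℂ} (hz : z ∈ M) :
    ‖z‖ = 1 ∨ ‖z‖ = 2 := by
  obtain ⟨M₁, M₂, h₁, h₂, rfl⟩ := h
  exact hz.imp (h₁.norm_eq zero_le_one) (h₂.norm_eq zero_le_two)

/-- The norm is constant along a path in a marking. -/
lemma IsMarking.norm_eq_of_path {M : Set ℂ} (h : IsMarking M) {f : ℝ → ℂ}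
    (hf : ContinuousOn f (Icc 0 1)) (hfM : ∀ t ∈ Icc (0 : ℝ) 1, f t ∈ M) {s t : ℝ}
    (hs : s ∈ Icc (0 : ℝ) 1) (ht : t ∈ Icc (0 : ℝ) 1) : ‖f s‖ = ‖f t‖ := by
  refine eq_of_mem_int_multiples isPreconnected_Icc (f := fun t => ‖f t‖) hf.norm one_pos 0
    (fun t ht => ?_) hs ht
  rcases h.norm_eq (hfM t ht) with h | h
  · exact ⟨1, by rw [h]; norm_num⟩
  · exact ⟨2, by rw [h]; norm_num⟩

/-- The norm on `M` takes only the values `1` and `2`. It is therefore constant along the tracks of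
both endpoints and along the final path, which would link the two circles. -/
lemma IsMarking.not_deformsInto {M : Set ℂ} (h : IsMarking M) {X : ℝ → ℂ} (hX : ‖X 0‖ ≠ ‖X 1‖) :
    ¬ DeformsInto M X := by
  rintro ⟨H, hH, -, h0, hM, hM1⟩
  have hc : ∀ t ∈ Icc (0 : ℝ) 1, ContinuousOn (fun s => H (s, t)) (Icc 0 1) := fun t ht =>
    hH.comp (by fun_prop) fun s hs => ⟨hs, ht⟩
  have e0 := h.norm_eq_of_path (hc 0 zero_mem_unit) (fun s hs => (hM s hs).1)
    zero_mem_unit one_mem_unit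
  have e1 := h.norm_eq_of_path (hc 1 one_mem_unit) (fun s hs => (hM s hs).2)
    zero_mem_unit one_mem_unit
  have e2 := h.norm_eq_of_path (f := fun t => H (1, t))
    (hH.comp (by fun_prop) fun t ht => ⟨one_mem_unit, ht⟩) hM1 zero_mem_unit one_mem_unit
  simp only [h0 0 zero_mem_unit, h0 1 one_mem_unit] at e0 e1
  exact hX (e0.trans (e2.trans e1.symm))

/-! ### A double pair for every marking -/

lemma norm_spiral (A B : ℂ) (u : ℝ) : ‖spiral A B u‖ = Real.exp (A.re + B.re * u) := by
  rw [spiral, Complex.norm_exp]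
  simp

lemma spiral_zero (A B : ℂ) : spiral A B 0 = Complex.exp A := by simp [spiral]

lemma spiral_one (A B : ℂ) : spiral A B 1 = Complex.exp (A + B) := by simp [spiral]

lemma log_two_pos : 0 < Real.log 2 := Real.log_pos (by norm_num)

lemma complex_log_two_re : (Complex.log 2).re = Real.log 2 := by simp [Complex.log_re]

lemma exp_log_two_add (z : ℂ) : Complex.exp (Real.log 2 + z) = 2 * Complex.exp z := by
  rw [Complex.exp_add, ← Complex.ofReal_exp, Real.exp_log two_pos]
  norm_num

lemma norm_crossing_spiral (p b u : ℝ) :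
    ‖spiral (p * Complex.I) (Real.log 2 + b * Complex.I) u‖ = Real.exp (Real.log 2 * u) := by
  rw [norm_spiral]
  simp [complex_log_two_re]

/-- A spiral between the two boundary circles is an arc. -/
lemma isArc_spiral {M : Set ℂ} (hM : IsMarking M) {p b : ℝ}
    (h0 : Complex.exp (p * Complex.I) ∈ M)
    (h1 : 2 * Complex.exp ((p + b : ℝ) * Complex.I) ∈ M) :
    IsArc M (spiral (p * Complex.I) (Real.log 2 + b * Complex.I)) := by
  have hl := log_two_pos
  have hre : ((Real.log 2 : ℂ) + b * Complex.I).re = Real.log 2 := by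
    simp [complex_log_two_re]
  have hB : (Real.log 2 : ℂ) + b * Complex.I ≠ 0 := fun h => hl.ne' (by
    rw [← hre, h, Complex.zero_re])
  refine
    { isImmersedCurve_spiral hB fun u hu => ?_ with
      injOn := ?_
      interior := ?_
      endpoints := ?_
      transverse := ?_
      essential := hM.not_deformsInto ?_ }
  · have h2 : ((p : ℂ) * Complex.I + (Real.log 2 + b * Complex.I) * u).re = Real.log 2 * u := by
      simp [complex_log_two_re]
    rw [h2]
    exact ⟨mul_nonneg hl.le hu.1, mul_le_of_le_one_right hl.le hu.2⟩
  · intro u _ v _ huv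
    have h2 := congrArg norm huv
    rw [norm_crossing_spiral, norm_crossing_spiral] at h2
    exact mul_left_cancel₀ hl.ne' (Real.exp_injective h2)
  · intro u hu
    rw [norm_crossing_spiral]
    refine ⟨Real.one_lt_exp_iff.2 (mul_pos hl hu.1), ?_⟩
    rw [← Real.lt_log_iff_exp_lt two_pos]
    exact mul_lt_of_lt_one_right hl hu.2
  · rw [spiral_zero, spiral_one]
    refine ⟨h0, ?_⟩
    rw [show (p : ℂ) * Complex.I + (Real.log 2 + b * Complex.I) =
      Real.log 2 + (p + b : ℝ) * Complex.I by push_cast; ring, exp_log_two_add]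
    exact h1
  · intro t ht c hc
    have ht' : t ∈ Icc (0 : ℝ) 1 := by rcases ht with rfl | rfl <;> simp
    rw [velocity_spiral _ _ ht', ← mul_assoc] at hc
    have h2 := congrArg Complex.re (mul_right_cancel₀ (spiral_ne_zero _ _ _) hc)
    rw [hre] at h2
    simp at h2
    norm_num at h2
  · rw [norm_crossing_spiral, norm_crossing_spiral]
    intro h
    have := Real.exp_injective h
    simp only [mul_zero, mul_one] at this
    exact hl.ne this

/-- Two spirals are joined by short boundary paths on both circles. All direction angles cancel in
the comparison of degrees, and only the increment of `ψ` around the loop is left. -/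
lemma IsAngle.eq_zero_of_isBalanced {η : Foliation} {ψ : ℂ → ℝ} {d : ℤ} (h : IsAngle η ψ d)
    {M : Set ℂ} (hM : IsMarking M) (hb : IsBalanced M η) : d = 0 := by
  obtain ⟨M₁, M₂, h₁, h₂, hM₁₂⟩ := id hM
  obtain ⟨p, δ₁, hδ₁, hp⟩ := h₁.exists_interval zero_le_one
  obtain ⟨q, δ₂, hδ₂, hq⟩ := h₂.exists_interval zero_le_two
  have hpi := Real.pi_pos
  obtain ⟨ε, hε, hεm⟩ : ∃ ε, 0 < ε ∧ ε < min (min δ₁ δ₂) Real.pi :=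
    exists_between (lt_min (lt_min hδ₁ hδ₂) hpi)
  have hε₁ : ε < δ₁ := hεm.trans_le ((min_le_left _ _).trans (min_le_left _ _))
  have hε₂ : ε < δ₂ := hεm.trans_le ((min_le_left _ _).trans (min_le_right _ _))
  have hεpi : ε < Real.pi := hεm.trans_le (min_le_right _ _)
  have hinner : ∀ θ : ℝ, |θ - p| < δ₁ → Complex.exp (θ * Complex.I) ∈ M := fun θ hθ => by
    rw [hM₁₂]; left; simpa using hp θ hθ
  have houter : ∀ θ : ℝ, |θ - q| < δ₂ → 2 * Complex.exp (θ * Complex.I) ∈ M := fun θ hθ => by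
    rw [hM₁₂]; right; simpa using hq θ hθ
  have hl := log_two_pos
  have hI := Complex.I_ne_zero
  have hεC : (ε : ℂ) ≠ 0 := by exact_mod_cast hε.ne'
  have hεI : (ε : ℂ) * Complex.I ≠ 0 := mul_ne_zero hεC hI
  set BX : ℂ := Real.log 2 + (q - p : ℝ) * Complex.I with hBX
  -- Reversed boundary orientation is counterclockwise inside and clockwise outside, so `Y` starts
  -- at `p + ε` and ends at `q - ε`. The extra `2π` makes it pass round the annulus instead of
  -- crossing `X`.
  set BY : ℂ := Real.log 2 + (q - p - 2 * ε + 2 * Real.pi : ℝ) * Complex.I with hBY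
  set AX : ℂ := (p : ℝ) * Complex.I with hAX
  set AY : ℂ := (p + ε : ℝ) * Complex.I with hAY
  have hBX0 : BX ≠ 0 := fun h0 => hl.ne' (by
    simpa [hBX, complex_log_two_re, -Real.log_eq_zero] using congrArg Complex.re h0)
  have hBY0 : BY ≠ 0 := fun h0 => hl.ne' (by
    simpa [hBY, complex_log_two_re, -Real.log_eq_zero] using congrArg Complex.re h0)
  have hpair : IsDoublePair M (spiral AX BX) (spiral AY BY) (spiral AX (ε * Complex.I))
      (spiral (AX + BX) (-(ε * Complex.I))) 0 0 1 1 := by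
    refine ⟨isArc_spiral hM (hinner p (by simpa)) ?_, isArc_spiral hM (hinner _ ?_) ?_, ?_, ?_, ?_,
      ?_, by simp⟩
    · rw [add_sub_cancel]
      exact houter q (by simpa)
    · simpa [abs_of_pos hε]
    · rw [show p + ε + (q - p - 2 * ε + 2 * Real.pi) = (q - ε) + 2 * Real.pi by ring]
      have := houter (q - ε) (by simpa [abs_of_pos hε])
      rw [Complex.ofReal_add, add_mul, Complex.exp_add]
      push_cast
      rw [Complex.exp_two_pi_mul_I, mul_one]
      exact_mod_cast this
    · rw [Set.disjoint_left]
      rintro _ ⟨u, hu, rfl⟩ ⟨v, hv, huv⟩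
      have h2 := congrArg norm huv
      rw [norm_crossing_spiral, norm_crossing_spiral] at h2
      obtain rfl : v = u := mul_left_cancel₀ hl.ne' (Real.exp_injective h2)
      obtain ⟨n, hn⟩ := Complex.exp_eq_exp_iff_exists_int.1 huv
      have h3 := congrArg Complex.im hn
      simp [hAX, hAY, hBX, hBY] at h3
      -- At equal radius the angular gap between the spirals runs from `ε` to `2π - ε`, so it is
      -- never a multiple of `2π`.
      have h4 : ε + v * (2 * Real.pi - 2 * ε) = n * (2 * Real.pi) := by linarith
      have h5 : 0 < (n : ℝ) * (2 * Real.pi) := by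
        rw [← h4]
        have := mul_nonneg hv.1 (by linarith : 0 ≤ 2 * Real.pi - 2 * ε)
        linarith
      have h6 : (n : ℝ) * (2 * Real.pi) < 1 * (2 * Real.pi) := by
        rw [← h4]
        have := mul_le_mul_of_nonneg_right hv.2 (by linarith : 0 ≤ 2 * Real.pi - 2 * ε)
        linarith
      have h7 : 0 < n := by exact_mod_cast pos_of_mul_pos_left h5 (by positivity)
      have h8 : n < 1 := by exact_mod_cast lt_of_mul_lt_mul_right h6 (by positivity)
      omega
    · have hn : ∀ u : ℝ, ‖spiral AX (ε * Complex.I) u‖ = 1 := fun u => by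
        rw [norm_spiral]; simp [hAX]
      refine { isImmersedCurve_spiral hεI fun u _ => ?_ with
        mem_marking := fun u hu => ?_
        direction := fun u hu => ⟨ε, hε, ?_⟩
        source := Or.inl rfl
        target := Or.inl rfl
        start := by rw [spiral_zero, spiral_zero]
        finish := ?_ }
      · simp [hAX, hl.le]
      · have := hinner (p + ε * u) (by
          rw [add_sub_cancel_left, abs_of_nonneg (mul_nonneg hε.le hu.1)]
          exact (mul_le_of_le_one_right hε.le hu.2).trans_lt hε₁)
        rw [spiral]
        convert this using 2
        push_cast
        ring
      · rw [velocity_spiral _ _ hu, reverseBoundary, if_pos (hn u), mul_assoc]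
      · rw [spiral_one, spiral_zero]
        congr 1
        rw [hAX, hAY]
        push_cast
        ring
    · have hn : ∀ u : ℝ, ‖spiral (AX + BX) (-(ε * Complex.I)) u‖ = 2 := fun u => by
        rw [norm_spiral]; simp [hAX, hBX, complex_log_two_re, Real.exp_log]
      refine { isImmersedCurve_spiral (neg_ne_zero.2 hεI) fun u _ => ?_ with
        mem_marking := fun u hu => ?_
        direction := fun u hu => ⟨ε, hε, ?_⟩
        source := Or.inr rfl
        target := Or.inr rfl
        start := by rw [spiral_zero, spiral_one]
        finish := ?_ }
      · simp [hAX, hBX, hl.le, complex_log_two_re]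
      · have := houter (q - ε * u) (by
          rw [sub_sub_cancel_left, abs_neg, abs_of_nonneg (mul_nonneg hε.le hu.1)]
          exact (mul_le_of_le_one_right hε.le hu.2).trans_lt hε₂)
        rw [spiral]
        rw [← exp_log_two_add] at this
        convert this using 2
        rw [hAX, hBX]
        push_cast
        ring
      · rw [velocity_spiral _ _ hu, reverseBoundary, if_neg (by rw [hn]; norm_num)]
        ring
      · rw [spiral_one, spiral_one, ← mul_one (Complex.exp _), ← Complex.exp_two_pi_mul_I,
          ← Complex.exp_add]
        congr 1
        rw [hAX, hAY, hBX, hBY]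
        push_cast
        ring
    · refine ⟨0, zero_mem_unit, fun h0 => ?_⟩
      have h2 := congrArg norm h0
      rw [norm_spiral, norm_spiral] at h2
      have := Real.exp_injective h2
      simp [hAX, hBX, complex_log_two_re, -Real.log_eq_zero] at this
      exact hl.ne this
  have hdeg := hb _ _ _ _ _ _ _ _ hpair _ _ _ _ (h.isGrading_spiral AX BX)
    (h.isGrading_spiral AY BY) (h.isGrading_spiral AX (ε * Complex.I))
    (h.isGrading_spiral (AX + BX) (-(ε * Complex.I)))
  have hcc : ∀ B A : ℂ, B ≠ 0 → ∀ (e : ℝ) (u : ℝ), e ≠ 0 →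
      ccwAngle (B * spiral A B u) (e * Complex.I * spiral A B u) = ccwAngle B Complex.I := by
    intro B A hB e u he
    rw [ccwAngle_mul_mul (spiral_ne_zero _ _ _), ccwAngle_mul_right he hB hI]
  have s1 : spiral AX (ε * Complex.I) 0 = spiral AX BX 0 := hpair.path.start
  have s2 : spiral AX (ε * Complex.I) 1 = spiral AY BY 0 := hpair.path.finish
  have s3 : spiral (AX + BX) (-(ε * Complex.I)) 0 = spiral AX BX 1 := hpair.path'.start
  have s4 : spiral (AX + BX) (-(ε * Complex.I)) 1 = spiral AY BY 1 := hpair.path'.finish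
  have hneg : -((ε : ℂ) * Complex.I) = ((-ε : ℝ) : ℂ) * Complex.I := by push_cast; ring
  have hne : -ε ≠ 0 := neg_ne_zero.2 hε.ne'
  simp only [pathDegree, intersectionIndex, velocity_spiral _ _ zero_mem_unit,
    velocity_spiral _ _ one_mem_unit, s1, s2, s3, s4] at hdeg
  rw [hneg, hcc _ _ hBX0 _ _ hε.ne', hcc _ _ hBY0 _ _ hε.ne', hcc _ _ hBX0 _ _ hne,
    hcc _ _ hBY0 _ _ hne] at hdeg
  simp only [Complex.ofReal_zero, Complex.ofReal_one, mul_zero, mul_one, add_zero] at hdeg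
  have t1 : AX + ε * Complex.I = AY := by rw [hAX, hAY]; push_cast; ring
  -- The lift of `Y` ends one full turn beyond the lift of the outer path, which is where `d π`
  -- enters.
  have t2 : AY + BY = AX + BX + ((-ε : ℝ) : ℂ) * Complex.I + 2 * Real.pi * Complex.I := by
    rw [hAX, hAY, hBX, hBY]; push_cast; ring
  rw [t1, t2, h.period] at hdeg
  field_simp at hdeg
  have : (d : ℝ) * Real.pi = 0 := by linarith
  exact_mod_cast (mul_eq_zero.1 this).resolve_right hpi.ne'

/-! ### Lifts of curves to the strip -/

/-- The coordinate `w` of the strip `0 ≤ re w ≤ log 2` with `z = r e^{σ w}` sends the boundary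
circle of radius `r` to the imaginary axis, and its reversed boundary orientation upwards. -/
def IsSide (r σ : ℝ) : Prop := r = 1 ∧ σ = 1 ∨ r = 2 ∧ σ = -1

/-- `Γ` is a lift of the curve `X` in the coordinate of the side `(r, σ)`, and has the
derivative `G`. -/
structure IsStripLift (r σ : ℝ) (X Γ G : ℝ → ℂ) : Prop where
  side : IsSide r σ
  continuous : Continuous G
  hasDerivAt : ∀ t, HasDerivAt Γ (G t) t
  eq_exp : ∀ t ∈ Icc (0 : ℝ) 1, X t = r * Complex.exp (σ * Γ t)
  velocity_eq : ∀ t ∈ Icc (0 : ℝ) 1, velocity X t = σ * G t * X t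

lemma IsSide.sq {r σ : ℝ} (h : IsSide r σ) : (σ : ℂ) * σ = 1 := by
  rcases h with ⟨-, rfl⟩ | ⟨-, rfl⟩ <;> norm_num

lemma IsSide.ne_zero {r σ : ℝ} (h : IsSide r σ) : σ ≠ 0 := by
  rcases h with ⟨-, rfl⟩ | ⟨-, rfl⟩ <;> norm_num

lemma IsSide.pos {r σ : ℝ} (h : IsSide r σ) : 0 < r := by
  rcases h with ⟨rfl, -⟩ | ⟨rfl, -⟩ <;> norm_num

lemma IsSide.norm_eq {r σ : ℝ} (h : IsSide r σ) (w : ℂ) :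
    ‖(r : ℂ) * Complex.exp (σ * w)‖ = r * Real.exp (σ * w.re) := by
  rw [norm_mul, Complex.norm_exp, Complex.norm_real, Real.norm_of_nonneg h.pos.le,
    Complex.re_ofReal_mul]

/-- Both `e^w` and `2 e^{-w}` carry the same strip to the annulus, with opposite edges on the
imaginary axis. Both are holomorphic, so the two boundary circles can be treated alike. -/
lemma IsSide.mem_annulus_iff {r σ : ℝ} (h : IsSide r σ) {w : ℂ} :
    (r : ℂ) * Complex.exp (σ * w) ∈ annulus ↔ 0 ≤ w.re ∧ w.re ≤ Real.log 2 := by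
  change 1 ≤ ‖_‖ ∧ ‖_‖ ≤ 2 ↔ _
  rw [h.norm_eq, Real.le_log_iff_exp_le two_pos, ← Real.one_le_exp_iff]
  rcases h with ⟨rfl, rfl⟩ | ⟨rfl, rfl⟩
  · simp
  · have := Real.exp_pos w.re
    rw [neg_one_mul, Real.exp_neg, ← div_eq_mul_inv, le_div_iff₀ this, div_le_iff₀ this]
    constructor <;> rintro ⟨h1, h2⟩ <;> constructor <;> linarith

lemma IsSide.norm_eq_iff {r σ : ℝ} (h : IsSide r σ) {w : ℂ} :
    ‖(r : ℂ) * Complex.exp (σ * w)‖ = r ↔ w.re = 0 := by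
  rw [h.norm_eq, mul_eq_left₀ h.pos.ne', Real.exp_eq_one_iff, mul_eq_zero,
    or_iff_right h.ne_zero]

lemma IsSide.re_eq_log_two {r σ : ℝ} (h : IsSide r σ) {w : ℂ}
    (h1 : ‖(r : ℂ) * Complex.exp (σ * w)‖ = 1 ∨ ‖(r : ℂ) * Complex.exp (σ * w)‖ = 2)
    (h2 : ‖(r : ℂ) * Complex.exp (σ * w)‖ ≠ r) : w.re = Real.log 2 := by
  rw [h.norm_eq] at h1 h2
  apply Real.exp_injective
  rw [Real.exp_log two_pos]
  rcases h with ⟨rfl, rfl⟩ | ⟨rfl, rfl⟩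
  · rw [one_mul, one_mul] at h1 h2
    exact h1.resolve_left h2
  · have h3 := h1.resolve_right h2
    rw [neg_one_mul, Real.exp_neg] at h3
    have := (Real.exp_pos w.re).ne'
    field_simp at h3
    exact h3.symm

lemma IsSide.exists_int {r σ : ℝ} (h : IsSide r σ) {w w' : ℂ}
    (hw : (r : ℂ) * Complex.exp (σ * w) = r * Complex.exp (σ * w')) :
    ∃ n : ℤ, w = w' + n * (2 * Real.pi * Complex.I) := by
  have hr : (r : ℂ) ≠ 0 := by exact_mod_cast h.pos.ne'
  obtain ⟨n, hn⟩ := Complex.exp_eq_exp_iff_exists_int.1 (mul_left_cancel₀ hr hw)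
  rcases h with ⟨-, rfl⟩ | ⟨-, rfl⟩
  · exact ⟨n, by simpa using hn⟩
  · refine ⟨-n, ?_⟩
    push_cast at hn ⊢
    linear_combination -hn

lemma IsSide.exp_add_int {r σ : ℝ} (h : IsSide r σ) (w : ℂ) (n : ℤ) :
    Complex.exp (σ * (w + n * (2 * Real.pi * Complex.I))) = Complex.exp (σ * w) := by
  rw [Complex.exp_eq_exp_iff_exists_int]
  rcases h with ⟨-, rfl⟩ | ⟨-, rfl⟩
  · exact ⟨n, by simp⟩
  · exact ⟨-n, by push_cast; ring⟩

lemma IsSide.exists_coord {r σ : ℝ} (h : IsSide r σ) {z : ℂ} (hz : z ≠ 0) :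
    ∃ w : ℂ, z = r * Complex.exp (σ * w) := by
  have hr : (r : ℂ) ≠ 0 := by exact_mod_cast h.pos.ne'
  refine ⟨σ * Complex.log (z / r), ?_⟩
  rw [← mul_assoc, h.sq, one_mul, Complex.exp_log (div_ne_zero hz hr), mul_div_cancel₀ _ hr]

lemma IsImmersedCurve.exists_stripLift {X : ℝ → ℂ} (hX : IsImmersedCurve X) {r σ : ℝ}
    (h : IsSide r σ) {w : ℂ} (hw : X 0 = r * Complex.exp (σ * w)) :
    ∃ Γ G, IsStripLift r σ X Γ G ∧ Γ 0 = w := by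
  have hr : (r : ℂ) ≠ 0 := by exact_mod_cast h.pos.ne'
  have h0 : ∀ t ∈ Icc (0 : ℝ) 1, X t ≠ 0 := fun t ht => ne_zero_of_mem_annulus (hX.mem t ht)
  have hvc : ContinuousOn (velocity X) (Icc 0 1) :=
    hX.smooth.continuousOn_derivWithin (uniqueDiffOn_Icc zero_lt_one) (by norm_num)
  -- Freezing the logarithmic derivative outside the unit interval gives a lift that is
  -- differentiable on the whole line.
  have hG : Continuous fun t => velocity X (clamp t) / X (clamp t) :=
    (hvc.div hX.smooth.continuousOn h0).comp_continuous continuous_clamp clamp_mem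
  obtain ⟨Γ, hΓ, hΓ0, hexp⟩ := exists_primitive_exp_eq (convex_Icc (0 : ℝ) 1) zero_mem_unit
    (X := fun t => X t / r) hG (fun t ht => by
      have := ((hX.smooth.differentiableOn (by norm_num)) t ht).hasDerivWithinAt.div_const (r : ℂ)
      refine this.congr_deriv ?_
      rw [clamp_of_mem ht, ← mul_div_assoc, div_mul_cancel₀ _ (h0 t ht), velocity])
    (w := σ * w) (by rw [hw, mul_div_cancel_left₀ _ hr])
  refine ⟨fun t => σ * Γ t, fun t => σ * (velocity X (clamp t) / X (clamp t)),
    ⟨h, by fun_prop, fun t => (hΓ t).const_mul _, fun t ht => ?_, fun t ht => ?_⟩, ?_⟩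
  · rw [← mul_assoc, h.sq, one_mul, hexp t ht, mul_div_cancel₀ _ hr]
  · rw [clamp_of_mem ht, ← mul_assoc, h.sq, one_mul, div_mul_cancel₀ _ (h0 t ht)]
  · simp only [hΓ0]
    rw [← mul_assoc, h.sq, one_mul]

namespace IsStripLift

variable {r σ : ℝ} {X Γ G : ℝ → ℂ}

lemma continuous_lift (h : IsStripLift r σ X Γ G) : Continuous Γ :=
  continuous_iff_continuousAt.2 fun t => (h.hasDerivAt t).continuousAt

lemma re_mem (h : IsStripLift r σ X Γ G) (hX : IsImmersedCurve X) {t : ℝ}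
    (ht : t ∈ Icc (0 : ℝ) 1) : 0 ≤ (Γ t).re ∧ (Γ t).re ≤ Real.log 2 := by
  rw [← h.side.mem_annulus_iff, ← h.eq_exp t ht]
  exact hX.mem t ht

lemma norm_eq_iff (h : IsStripLift r σ X Γ G) {t : ℝ} (ht : t ∈ Icc (0 : ℝ) 1) :
    ‖X t‖ = r ↔ (Γ t).re = 0 := by
  rw [h.eq_exp t ht, h.side.norm_eq_iff]

lemma ne_zero (h : IsStripLift r σ X Γ G) (hX : IsImmersedCurve X) {t : ℝ}
    (ht : t ∈ Icc (0 : ℝ) 1) : G t ≠ 0 := by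
  intro h0
  apply hX.immersed t ht
  rw [h.velocity_eq t ht, h0, mul_zero, zero_mul]

lemma injOn (h : IsStripLift r σ X Γ G) (hX : InjOn X (Icc 0 1)) : InjOn Γ (Icc 0 1) := by
  intro a ha b hb hab
  apply hX ha hb
  rw [h.eq_exp a ha, h.eq_exp b hb, hab]

/-- The boundary direction is vertical in the strip coordinate, so transversality means a
non-vertical derivative. -/
lemma re_deriv_ne_zero (h : IsStripLift r σ X Γ G) {M : Set ℂ} (hX : IsArc M X) {t : ℝ}
    (ht : t = 0 ∨ t = 1) : (G t).re ≠ 0 := by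
  have ht' : t ∈ Icc (0 : ℝ) 1 := by rcases ht with rfl | rfl <;> simp
  intro h0
  apply hX.transverse t ht (σ * (G t).im)
  rw [h.velocity_eq t ht']
  nth_rewrite 1 [eq_im_mul_I h0]
  push_cast
  ring

/-- An arc leaves its initial boundary circle. -/
lemma re_deriv_zero_pos (h : IsStripLift r σ X Γ G) {M : Set ℂ} (hX : IsArc M X)
    (h0 : (Γ 0).re = 0) : 0 < (G 0).re := by
  refine lt_of_le_of_ne ?_ (h.re_deriv_ne_zero hX (Or.inl rfl)).symm
  have hs := continuous_secant h.continuous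
  have hcl : IsClosed {t : ℝ | 0 ≤ (secant G (0, t)).re} :=
    isClosed_le continuous_const (by fun_prop)
  have hsub : Ioo (0 : ℝ) 1 ⊆ {t : ℝ | 0 ≤ (secant G (0, t)).re} := fun t ht =>
    re_secant_nonneg h.continuous h.hasDerivAt ht.1
      (by rw [h0]; exact (h.re_mem hX.toIsImmersedCurve (Ioo_subset_Icc_self ht)).1)
  have := hcl.closure_subset_iff.2 hsub
  rw [closure_Ioo zero_ne_one] at this
  have h1 := this zero_mem_unit
  rwa [mem_ofPred_eq, secant_self] at h1

lemma re_deriv_one_nonneg (h : IsStripLift r σ X Γ G)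
    (hmax : ∀ t ∈ Icc (0 : ℝ) 1, (Γ t).re ≤ (Γ 1).re) : 0 ≤ (G 1).re := by
  have hs := continuous_secant h.continuous
  have hcl : IsClosed {t : ℝ | 0 ≤ (secant G (t, 1)).re} :=
    isClosed_le continuous_const (by fun_prop)
  have hsub : Ioo (0 : ℝ) 1 ⊆ {t : ℝ | 0 ≤ (secant G (t, 1)).re} := fun t ht =>
    re_secant_nonneg h.continuous h.hasDerivAt ht.2 (hmax t (Ioo_subset_Icc_self ht))
  have := hcl.closure_subset_iff.2 hsub
  rw [closure_Ioo zero_ne_one] at this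
  have h1 := this one_mem_unit
  rwa [mem_ofPred_eq, secant_self] at h1

lemma re_deriv_one_nonpos (h : IsStripLift r σ X Γ G)
    (hmin : ∀ t ∈ Icc (0 : ℝ) 1, (Γ 1).re ≤ (Γ t).re) : (G 1).re ≤ 0 := by
  have hs := continuous_secant h.continuous
  have hcl : IsClosed {t : ℝ | (secant G (t, 1)).re ≤ 0} :=
    isClosed_le (by fun_prop) continuous_const
  have hsub : Ioo (0 : ℝ) 1 ⊆ {t : ℝ | (secant G (t, 1)).re ≤ 0} := fun t ht =>
    re_secant_nonpos h.continuous h.hasDerivAt ht.2 (hmin t (Ioo_subset_Icc_self ht))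
  have := hcl.closure_subset_iff.2 hsub
  rw [closure_Ioo zero_ne_one] at this
  have h1 := this one_mem_unit
  rwa [mem_ofPred_eq, secant_self] at h1

end IsStripLift

/-! ### Indices at the ends of arcs -/

/-- The index of a graded arc with the boundary at its end `X s`, times `π`, for a foliation with
the angle `Ψ`. -/
noncomputable def endIndex (Ψ : ℂ → ℝ) (X : ℝ → ℂ) (x : ℝ → ℝ) (s : ℝ) : ℝ :=
  -x s + Ψ (X s) + ccwAngle (velocity X s) (Complex.I * X s)

/-- The direction angle of an arc determines the difference of its end indices. -/
lemma endIndex_sub {η : Foliation} {Ψ : ℂ → ℝ} (hΨ : ContinuousOn Ψ annulus)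
    (hη : ∀ z (hz : z ∈ annulus), η ⟨z, hz⟩ = rotatedLine z (ne_zero_of_mem_annulus hz) (Ψ z))
    {r σ : ℝ} {X Γ G : ℝ → ℂ} (h : IsStripLift r σ X Γ G) (hX : IsImmersedCurve X) {x : ℝ → ℝ}
    (hx : IsGrading η X x) {ℓ : ℝ → ℂ} (hℓ : Continuous ℓ)
    (hexp : ∀ t ∈ Icc (0 : ℝ) 1, Complex.exp (ℓ t) = G t) {κ₀ κ₁ : ℤ}
    (h0 : (ℓ 0).im ∈ Ioo (κ₀ * Real.pi - Real.pi / 2) (κ₀ * Real.pi + Real.pi / 2))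
    (h1 : (ℓ 1).im ∈ Ioo (κ₁ * Real.pi - Real.pi / 2) (κ₁ * Real.pi + Real.pi / 2)) :
    endIndex Ψ X x 1 - endIndex Ψ X x 0 = (κ₁ - κ₀) * Real.pi := by
  have hσ := h.side.ne_zero
  have hv : ∀ t ∈ Icc (0 : ℝ) 1, velocity X t = σ * Complex.exp (ℓ t) * X t := fun t ht => by
    rw [h.velocity_eq t ht, hexp t ht]
  have hconst := hx.sub_add_eq hΨ hη hX.smooth.continuousOn hX.mem (θ := fun t => (ℓ t).im)
    (by fun_prop) (fun t ht => ⟨σ * Real.exp (ℓ t).re, mul_ne_zero hσ (Real.exp_pos _).ne', by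
      rw [hv t ht, Complex.ofReal_mul, Complex.ofReal_exp,
        mul_assoc (σ : ℂ) (Complex.exp ((ℓ t).re : ℂ)), ← Complex.exp_add, Complex.re_add_im]⟩) zero_mem_unit one_mem_unit
  -- At an end with half-turn `κ` the angle to the boundary is `π/2 - Im ℓ + κ π`. Together with the
  -- constancy of `x - Ψ + Im ℓ`, only `κ π` varies between the ends.
  rw [endIndex, endIndex, hv 0 zero_mem_unit, hv 1 one_mem_unit,
    ccwAngle_mul_mul (ne_zero_of_mem_annulus (hX.mem 0 zero_mem_unit)),
    ccwAngle_mul_mul (ne_zero_of_mem_annulus (hX.mem 1 one_mem_unit)), ccwAngle_exp_I hσ h0,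
    ccwAngle_exp_I hσ h1]
  linarith

lemma exists_isSide {M : Set ℂ} (hM : IsMarking M) {z : ℂ} (hz : z ∈ M) : ∃ σ, IsSide ‖z‖ σ := by
  rcases hM.norm_eq hz with h | h
  · exact ⟨1, Or.inl ⟨h, rfl⟩⟩
  · exact ⟨-1, Or.inr ⟨h, rfl⟩⟩

/-- The two end indices of an arc between the boundary circles agree. -/
lemma endIndex_eq_of_crossing {η : Foliation} {Ψ : ℂ → ℝ} (hΨ : ContinuousOn Ψ annulus)
    (hη : ∀ z (hz : z ∈ annulus), η ⟨z, hz⟩ = rotatedLine z (ne_zero_of_mem_annulus hz) (Ψ z))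
    {M : Set ℂ} (hM : IsMarking M) {X : ℝ → ℂ} (hX : IsArc M X) (hne : ‖X 0‖ ≠ ‖X 1‖) {x : ℝ → ℝ}
    (hx : IsGrading η X x) : endIndex Ψ X x 0 = endIndex Ψ X x 1 := by
  obtain ⟨σ, hside⟩ := exists_isSide hM hX.endpoints.1
  have hX' := hX.toIsImmersedCurve
  obtain ⟨w, hw⟩ := hside.exists_coord (ne_zero_of_mem_annulus (hX.mem 0 zero_mem_unit))
  obtain ⟨Γ, G, h, -⟩ := hX'.exists_stripLift hside hw
  have h0 : (Γ 0).re = 0 := (h.norm_eq_iff zero_mem_unit).1 rfl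
  have h1 : (Γ 1).re = Real.log 2 := by
    have e1 := hM.norm_eq hX.endpoints.2
    have e2 := hne.symm
    have e3 := h.eq_exp 1 one_mem_unit
    generalize ‖X 0‖ = r at *
    rw [e3] at e1 e2
    exact h.side.re_eq_log_two e1 e2
  have hmax : ∀ t ∈ Icc (0 : ℝ) 1, (Γ t).re ≤ (Γ 1).re := fun t ht => by
    rw [h1]; exact (h.re_mem hX' ht).2
  obtain ⟨ℓ, hℓ, hexp, κ, hκ0, hκ1⟩ := exists_log_deriv_of_crossing h.continuous h.hasDerivAt
    (fun t ht => h.ne_zero hX' ht) (h.injOn hX.injOn)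
    (fun t ht => by rw [h0]; exact (h.re_mem hX' ht).1) hmax (h.re_deriv_zero_pos hX h0)
    (lt_of_le_of_ne (h.re_deriv_one_nonneg hmax) (h.re_deriv_ne_zero hX (Or.inr rfl)).symm)
  have := endIndex_sub hΨ hη h hX' hx hℓ hexp hκ0 hκ1
  rw [sub_self, zero_mul] at this
  linarith

/-- The two end indices of an arc with both ends on one boundary circle differ by one. -/
lemma endIndex_eq_of_returning {η : Foliation} {Ψ : ℂ → ℝ} (hΨ : ContinuousOn Ψ annulus)
    (hη : ∀ z (hz : z ∈ annulus), η ⟨z, hz⟩ = rotatedLine z (ne_zero_of_mem_annulus hz) (Ψ z))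
    {M : Set ℂ} {r σ : ℝ} {X Γ G : ℝ → ℂ} (h : IsStripLift r σ X Γ G) (hX : IsArc M X)
    (h0 : (Γ 0).re = 0) (h1 : (Γ 1).re = 0) {x : ℝ → ℝ} (hx : IsGrading η X x) {s s' : ℝ}
    (hs : s = 0 ∧ s' = 1 ∨ s = 1 ∧ s' = 0) (hlt : (Γ s).im < (Γ s').im) :
    endIndex Ψ X x s' = endIndex Ψ X x s + Real.pi := by
  have hX' := hX.toIsImmersedCurve
  have hmin : ∀ t ∈ Icc (0 : ℝ) 1, (Γ 0).re ≤ (Γ t).re := fun t ht => by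
    rw [h0]; exact (h.re_mem hX' ht).1
  have hend : (Γ 1).re = (Γ 0).re := by rw [h0, h1]
  obtain ⟨ℓ, hℓ, hexp, κ₀, κ₁, hκ0, hκ1, hup, hdown⟩ :=
    exists_log_deriv_of_returning h.continuous h.hasDerivAt
      (fun t ht => h.ne_zero hX' ht) (h.injOn hX.injOn) hmin hend (h.re_deriv_zero_pos hX h0)
      (lt_of_le_of_ne (h.re_deriv_one_nonpos (hend ▸ hmin)) (h.re_deriv_ne_zero hX (Or.inr rfl)))
  have := endIndex_sub hΨ hη h hX' hx hℓ hexp hκ0 hκ1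
  rcases hs with ⟨rfl, rfl⟩ | ⟨rfl, rfl⟩
  · rw [hup hlt] at this
    push_cast at this
    linarith
  · rw [hdown hlt] at this
    push_cast at this
    linarith

lemma reverseBoundary_eq {r σ : ℝ} (h : IsSide r σ) {z : ℂ} (hz : ‖z‖ = r) :
    reverseBoundary z = σ * (Complex.I * z) := by
  rcases h with ⟨rfl, rfl⟩ | ⟨rfl, rfl⟩
  · rw [reverseBoundary, if_pos hz]
    simp
  · rw [reverseBoundary, if_neg (by rw [hz]; norm_num)]
    simp

lemma IsBoundaryPath.exists_velocity_eq {M : Set ℂ} {X Y γ : ℝ → ℂ} {s t : ℝ}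
    (h : IsBoundaryPath M X Y γ s t) {u : ℝ} (hu : u ∈ Icc (0 : ℝ) 1) :
    ∃ c : ℝ, c ≠ 0 ∧ velocity γ u = c * (Complex.I * γ u) := by
  obtain ⟨c, hc, hv⟩ := h.direction u hu
  rw [hv, reverseBoundary]
  split_ifs
  · exact ⟨c, hc.ne', rfl⟩
  · exact ⟨-c, neg_ne_zero.2 hc.ne', by push_cast; ring⟩

/-- The degree of a boundary path is the difference of end indices. -/
lemma pathDegree_eq {η : Foliation} {Ψ : ℂ → ℝ} (hΨ : ContinuousOn Ψ annulus)
    (hη : ∀ z (hz : z ∈ annulus), η ⟨z, hz⟩ = rotatedLine z (ne_zero_of_mem_annulus hz) (Ψ z))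
    {M : Set ℂ} {X Y γ : ℝ → ℂ} {s t : ℝ} (hX : IsArc M X) (hY : IsArc M Y)
    (h : IsBoundaryPath M X Y γ s t) {x y g : ℝ → ℝ} (hg : IsGrading η γ g) :
    pathDegree X Y γ s t x y g = (endIndex Ψ X x s - endIndex Ψ Y y t) / Real.pi := by
  have hs : s ∈ Icc (0 : ℝ) 1 := by rcases h.source with rfl | rfl <;> simp
  have ht : t ∈ Icc (0 : ℝ) 1 := by rcases h.target with rfl | rfl <;> simp
  -- A path in the boundary always makes the angle `π/2` with the radial line, so `g - Ψ` is
  -- constant along it and cancels in the degree.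
  have hconst := hg.sub_add_eq hΨ hη h.smooth.continuousOn h.mem (θ := fun _ => Real.pi / 2)
    continuousOn_const (fun u hu => by
      obtain ⟨c, hc, hv⟩ := h.exists_velocity_eq hu
      refine ⟨c, hc, ?_⟩
      rw [hv]
      push_cast
      rw [Complex.exp_pi_div_two_mul_I, mul_assoc]) zero_mem_unit one_mem_unit
  obtain ⟨c, hc, hv⟩ := h.exists_velocity_eq zero_mem_unit
  obtain ⟨c', hc', hv'⟩ := h.exists_velocity_eq one_mem_unit
  have hXs := ne_zero_of_mem_annulus (hX.mem s hs)
  have hYt := ne_zero_of_mem_annulus (hY.mem t ht)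
  rw [h.start] at hv
  rw [h.finish] at hv'
  simp only [h.start, h.finish] at hconst
  rw [pathDegree, intersectionIndex, intersectionIndex, hv, hv',
    ccwAngle_mul_right hc (hX.immersed s hs) (mul_ne_zero Complex.I_ne_zero hXs),
    ccwAngle_mul_right hc' (hY.immersed t ht) (mul_ne_zero Complex.I_ne_zero hYt), ← sub_div,
    endIndex, endIndex]
  congr 1
  linarith

/-! ### Arcs with both ends on one boundary circle -/

/-- An essential arc with both ends on one boundary circle has an unmarked point between the ends
of its lift. -/
lemma IsArc.exists_notMem {M : Set ℂ} {r σ : ℝ} {X Γ G : ℝ → ℂ} (hX : IsArc M X)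
    (h : IsStripLift r σ X Γ G) (h0 : (Γ 0).re = 0) (h1 : (Γ 1).re = 0) :
    ∃ θ ∈ uIcc (Γ 0).im (Γ 1).im, (r : ℂ) * Complex.exp (σ * (θ * Complex.I)) ∉ M := by
  by_contra! hall
  have hc := h.continuous_lift
  have hX' := hX.toIsImmersedCurve
  -- If the chord of the lift on the imaginary axis were entirely marked, the straight-line homotopy
  -- in the strip from the lift to this chord would deform the arc into `M`.
  refine hX.essential ⟨fun p => r * Complex.exp (σ * ((1 - p.1 : ℝ) * Γ p.2 +
    (p.1 : ℝ) * ((1 - p.2 : ℝ) * Γ 0 + (p.2 : ℝ) * Γ 1))), by fun_prop, fun a ha t ht => ?_,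
    fun t ht => ?_, fun a _ => ⟨?_, ?_⟩, fun t ht => ?_⟩
  · rw [h.side.mem_annulus_iff]
    have hb := h.re_mem hX' ht
    have ha' := sub_nonneg.2 ha.2
    simp only [Complex.add_re, Complex.re_ofReal_mul, h0, h1, mul_zero, add_zero]
    exact ⟨mul_nonneg ha' hb.1, (mul_le_of_le_one_left hb.1 (by linarith [ha.1])).trans hb.2⟩
  · rw [h.eq_exp t ht]
    simp
  · convert hX.endpoints.1 using 1
    rw [h.eq_exp 0 zero_mem_unit]
    push_cast
    ring_nf
  · convert hX.endpoints.2 using 1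
    rw [h.eq_exp 1 one_mem_unit]
    push_cast
    ring_nf
  · have hθ : (1 - t) * (Γ 0).im + t * (Γ 1).im ∈ uIcc (Γ 0).im (Γ 1).im := by
      rw [← segment_eq_uIcc]
      exact ⟨1 - t, t, sub_nonneg.2 ht.2, ht.1, by ring, rfl⟩
    convert hall _ hθ using 4
    apply Complex.ext <;> simp [h0, h1]

/-- A boundary path lifts to an increasing path on the imaginary axis. -/
lemma IsBoundaryPath.exists_lift {M : Set ℂ} (hM : IsMarking M) {X Y γ : ℝ → ℂ} {s t : ℝ}
    (hγ : IsBoundaryPath M X Y γ s t) {r σ : ℝ} (hside : IsSide r σ) {w : ℂ}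
    (hw : X s = r * Complex.exp (σ * w)) (hw0 : w.re = 0) :
    ∃ w' : ℂ, w'.re = 0 ∧ Y t = r * Complex.exp (σ * w') ∧ w.im < w'.im ∧
      ∀ θ ∈ Icc w.im w'.im, (r : ℂ) * Complex.exp (σ * (θ * Complex.I)) ∈ M := by
  have hγ' := hγ.toIsImmersedCurve
  obtain ⟨Γ, G, h, rfl⟩ := hγ'.exists_stripLift hside (w := w) (by rw [hγ.start, hw])
  have hn0 : ‖γ 0‖ = r := (h.norm_eq_iff zero_mem_unit).2 hw0
  have hn : ∀ u ∈ Icc (0 : ℝ) 1, ‖γ u‖ = r := fun u hu => by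
    rw [← hn0]
    exact hM.norm_eq_of_path hγ.smooth.continuousOn hγ.mem_marking hu zero_mem_unit
  have hre : ∀ u ∈ Icc (0 : ℝ) 1, (Γ u).re = 0 := fun u hu => (h.norm_eq_iff hu).1 (hn u hu)
  have hG : ∀ u ∈ Icc (0 : ℝ) 1, 0 < (G u).im := by
    intro u hu
    obtain ⟨c, hc, hv⟩ := hγ.direction u hu
    rw [h.velocity_eq u hu, reverseBoundary_eq hside (hn u hu)] at hv
    have hσ : (σ : ℂ) ≠ 0 := by exact_mod_cast hside.ne_zero
    have h0 := ne_zero_of_mem_annulus (hγ.mem u hu)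
    have : G u = c * Complex.I :=
      mul_left_cancel₀ (mul_ne_zero hσ h0) (by linear_combination hv)
    rw [this]
    simpa using hc
  have hd : ∀ u, HasDerivAt (fun u => (Γ u).im) (G u).im u := fun u =>
    Complex.imCLM.hasFDerivAt.comp_hasDerivAt u (h.hasDerivAt u)
  have hc : Continuous fun u => (Γ u).im := Complex.continuous_im.comp h.continuous_lift
  have hmono : StrictMonoOn (fun u => (Γ u).im) (Icc 0 1) :=
    strictMonoOn_of_deriv_pos (convex_Icc 0 1) hc.continuousOn fun u hu => by
      rw [(hd u).deriv]
      exact hG u (interior_subset hu)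
  refine ⟨Γ 1, hre 1 one_mem_unit, by rw [← hγ.finish, h.eq_exp 1 one_mem_unit],
    hmono zero_mem_unit one_mem_unit zero_lt_one, fun θ hθ => ?_⟩
  obtain ⟨u, hu, rfl⟩ := intermediate_value_Icc zero_le_one hc.continuousOn hθ
  rw [← eq_im_mul_I (hre u hu), ← h.eq_exp u hu]
  exact hγ.mem_marking u hu

/-- If a boundary path leads from the lower end of the lift of an arc to an end of a disjoint arc,
then the latter is the lower end, too. -/
lemma im_lt_im_of_path {M : Set ℂ} (hM : IsMarking M) {r σ : ℝ} {X Y γ ΓX GX ΓY GY : ℝ → ℂ}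
    {s t s' t' : ℝ} (hX : IsArc M X) (hY : IsArc M Y)
    (hdisj : Disjoint (X '' Icc 0 1) (Y '' Icc 0 1)) (hγ : IsBoundaryPath M X Y γ s t)
    (hs : s = 0 ∧ s' = 1 ∨ s = 1 ∧ s' = 0) (ht : t = 0 ∧ t' = 1 ∨ t = 1 ∧ t' = 0)
    (hlX : IsStripLift r σ X ΓX GX) (hlY : IsStripLift r σ Y ΓY GY)
    (hX0 : (ΓX 0).re = 0) (hX1 : (ΓX 1).re = 0) (hY0 : (ΓY 0).re = 0) (hY1 : (ΓY 1).re = 0)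
    (hlt : (ΓX s).im < (ΓX s').im) : (ΓY t).im < (ΓY t').im := by
  by_contra hge
  rw [not_lt] at hge
  have hside := hlX.side
  have hends : ∀ {a b : ℝ}, (a = 0 ∧ b = 1 ∨ a = 1 ∧ b = 0) →
      a ∈ Icc (0 : ℝ) 1 ∧ ∀ u ∈ Icc (0 : ℝ) 1, a + u * (b - a) ∈ Icc (0 : ℝ) 1 := by
    rintro a b (⟨rfl, rfl⟩ | ⟨rfl, rfl⟩)
    · exact ⟨zero_mem_unit, fun u hu => by simpa using hu⟩
    · exact ⟨one_mem_unit, fun u hu => ⟨by linarith [hu.2], by linarith [hu.1]⟩⟩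
  have hXs : (ΓX s).re = 0 := by rcases hs with ⟨rfl, -⟩ | ⟨rfl, -⟩ <;> assumption
  have hXs' : (ΓX s').re = 0 := by rcases hs with ⟨-, rfl⟩ | ⟨-, rfl⟩ <;> assumption
  have hYt : (ΓY t).re = 0 := by rcases ht with ⟨rfl, -⟩ | ⟨rfl, -⟩ <;> assumption
  have hYt' : (ΓY t').re = 0 := by rcases ht with ⟨-, rfl⟩ | ⟨-, rfl⟩ <;> assumption
  obtain ⟨w', hw', hYw, hlt', hmark⟩ := hγ.exists_lift hM hside
    (hlX.eq_exp s (hends hs).1) hXs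
  rw [hlY.eq_exp t (hends ht).1] at hYw
  obtain ⟨n, hn⟩ := hside.exists_int hYw.symm
  have him : w'.im = (ΓY t).im + n * (2 * Real.pi) := by rw [hn]; simp
  obtain ⟨θ₁, hθ₁, hM₁⟩ := hX.exists_notMem hlX hX0 hX1
  obtain ⟨θ₂, hθ₂, hM₂⟩ := hY.exists_notMem hlY hY0 hY1
  have hθ₁' : θ₁ ∈ Icc (ΓX s).im (ΓX s').im := by
    rw [← uIcc_of_le hlt.le]
    rcases hs with ⟨rfl, rfl⟩ | ⟨rfl, rfl⟩
    · exact hθ₁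
    · rwa [uIcc_comm]
  have hθ₂' : θ₂ ∈ Icc (ΓY t').im (ΓY t).im := by
    rw [← uIcc_of_le hge]
    rcases ht with ⟨rfl, rfl⟩ | ⟨rfl, rfl⟩
    · rwa [uIcc_comm]
    · exact hθ₂
  -- Suppose the path reaches the upper end of `Y`. It is marked throughout, so it stops before the
  -- unmarked point of `X`, and the translated unmarked point of `Y` lies below its start. The
  -- heights are therefore interleaved: lower `Y`, lower `X`, upper `Y`, upper `X`.
  have i1 : w'.im < θ₁ := by
    by_contra hc
    exact hM₁ (hmark θ₁ ⟨hθ₁'.1, not_lt.1 hc⟩)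
  have i2 : θ₂ + n * (2 * Real.pi) < (ΓX s).im := by
    by_contra hc
    apply hM₂
    have := hmark (θ₂ + n * (2 * Real.pi)) ⟨not_lt.1 hc, by linarith [hθ₂'.2]⟩
    rw [show ((θ₂ + n * (2 * Real.pi) : ℝ) : ℂ) * Complex.I =
      θ₂ * Complex.I + n * (2 * Real.pi * Complex.I) by push_cast; ring,
      hside.exp_add_int] at this
    exact this
  have hYc := hlY.continuous_lift
  have hXc := hlX.continuous_lift
  have hre : ∀ z : ℂ, (z + n * (2 * Real.pi * Complex.I)).re = z.re := fun z => by simp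
  have him' : ∀ z : ℂ, (z + n * (2 * Real.pi * Complex.I)).im = z.im + n * (2 * Real.pi) :=
    fun z => by simp
  have ht' : t' = 0 ∧ t = 1 ∨ t' = 1 ∧ t = 0 := by tauto
  have at0 : ∀ a b : ℝ, a + 0 * (b - a) = a := fun a b => by ring
  have at1 : ∀ a b : ℝ, a + 1 * (b - a) = b := fun a b => by ring
  obtain ⟨a, ha, b, hb, hab⟩ := exists_eq_of_interleaved
    -- Both lifts are reparametrized to run from their lower to their upper ends, whatever the
    -- orientation of the arcs. That of `Y` is moved to the sheet reached by the boundary path.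
    (α := fun u => ΓY (t' + u * (t - t')) + n * (2 * Real.pi * Complex.I))
    (β := fun u => ΓX (s + u * (s' - s))) (by fun_prop) (by fun_prop)
    (fun u hu => by rw [hre]; exact (hlY.re_mem hY.toIsImmersedCurve ((hends ht').2 u hu)).1)
    (fun u hu => (hlX.re_mem hX.toIsImmersedCurve ((hends hs).2 u hu)).1)
    (by rw [hre, at0, hYt']) (by rw [hre, at1, hYt]) (by rw [at0, hXs]) (by rw [at1, hXs'])
    (by rw [him', at0, at0]; linarith [hθ₂'.1])
    (by rw [him', at0, at1]; linarith)
    (by rw [him', at1, at1]; linarith [hθ₁'.2])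
  refine Set.disjoint_left.1 hdisj ⟨_, (hends hs).2 b hb, rfl⟩ ⟨_, (hends ht').2 a ha, ?_⟩
  rw [hlX.eq_exp _ ((hends hs).2 b hb), hlY.eq_exp _ ((hends ht').2 a ha), ← hab,
    hside.exp_add_int]

/-! ### Balance of foliations of degree zero. -/

lemma IsBoundaryPath.norm_eq {M : Set ℂ} (hM : IsMarking M) {X Y γ : ℝ → ℂ} {s t : ℝ}
    (hγ : IsBoundaryPath M X Y γ s t) : ‖X s‖ = ‖Y t‖ := by
  rw [← hγ.start, ← hγ.finish]
  exact hM.norm_eq_of_path hγ.smooth.continuousOn hγ.mem_marking zero_mem_unit one_mem_unit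

lemma ends_of_ne {s s' : ℝ} (hs : s = 0 ∨ s = 1) (hs' : s' = 0 ∨ s' = 1) (hne : s ≠ s') :
    s = 0 ∧ s' = 1 ∨ s = 1 ∧ s' = 0 := by
  rcases hs with rfl | rfl <;> rcases hs' with rfl | rfl <;> simp at hne ⊢

/-- Degrees depend only on the ends that are joined, so paths between the same ends are settled at
once. Otherwise boundary paths preserve the circle, so `X` and `Y` are both crossing or both return
to one circle, and their end indices jump by the same amount. -/
lemma IsAngle.isBalanced {η : Foliation} {ψ : ℂ → ℝ} (h : IsAngle η ψ 0) {M : Set ℂ}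
    (hM : IsMarking M) : IsBalanced M η := by
  intro X Y γ γ' s t s' t' hp x y g g' hx hy hg hg'
  obtain ⟨Ψ, hΨ, hη⟩ := h.exists_global
  have hX := hp.arc_left
  have hY := hp.arc_right
  rw [pathDegree_eq hΨ hη hX hY hp.path hg, pathDegree_eq hΨ hη hX hY hp.path' hg']
  congr 1
  by_cases hss : s = s'
  · rw [hss, hp.loop.1 hss]
  have hs := ends_of_ne hp.path.source hp.path'.source hss
  have ht := ends_of_ne hp.path.target hp.path'.target (fun e => hss (hp.loop.2 e))
  have hs' : s' = 0 ∧ s = 1 ∨ s' = 1 ∧ s = 0 := by tauto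
  have ht' : t' = 0 ∧ t = 1 ∨ t' = 1 ∧ t = 0 := by tauto
  have hn := hp.path.norm_eq hM
  have hn' := hp.path'.norm_eq hM
  by_cases hXn : ‖X 0‖ = ‖X 1‖
  · have hXe : ‖X s‖ = ‖X 0‖ ∧ ‖X s'‖ = ‖X 0‖ := by
      rcases hs with ⟨rfl, rfl⟩ | ⟨rfl, rfl⟩ <;> simp [hXn]
    have hYe : ‖Y 0‖ = ‖X 0‖ ∧ ‖Y 1‖ = ‖X 0‖ := by
      rcases ht with ⟨rfl, rfl⟩ | ⟨rfl, rfl⟩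
      · exact ⟨hn.symm.trans hXe.1, hn'.symm.trans hXe.2⟩
      · exact ⟨hn'.symm.trans hXe.2, hn.symm.trans hXe.1⟩
    obtain ⟨σ, hside⟩ := exists_isSide hM hX.endpoints.1
    obtain ⟨wX, hwX⟩ := hside.exists_coord (ne_zero_of_mem_annulus (hX.mem 0 zero_mem_unit))
    obtain ⟨ΓX, GX, hlX, -⟩ := hX.toIsImmersedCurve.exists_stripLift hside hwX
    obtain ⟨wY, hwY⟩ := hside.exists_coord (ne_zero_of_mem_annulus (hY.mem 0 zero_mem_unit))
    obtain ⟨ΓY, GY, hlY, -⟩ := hY.toIsImmersedCurve.exists_stripLift hside hwY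
    have hX0 := (hlX.norm_eq_iff zero_mem_unit).1 rfl
    have hX1 := (hlX.norm_eq_iff one_mem_unit).1 hXn.symm
    have hY0 := (hlY.norm_eq_iff zero_mem_unit).1 hYe.1
    have hY1 := (hlY.norm_eq_iff one_mem_unit).1 hYe.2
    have hne : (ΓX 0).im ≠ (ΓX 1).im := fun e => zero_ne_one
      (hlX.injOn hX.injOn zero_mem_unit one_mem_unit (Complex.ext (hX0.trans hX1.symm) e))
    have hne' : (ΓX s).im ≠ (ΓX s').im := by
      rcases hs with ⟨rfl, rfl⟩ | ⟨rfl, rfl⟩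
      · exact hne
      · exact hne.symm
    -- The matching of lower ends is applied to whichever of `γ` and `γ'` starts at the lower end of
    -- `X`.
    rcases hne'.lt_or_gt with hlt | hlt
    · have hlt' := im_lt_im_of_path hM hX hY hp.disjoint hp.path hs ht hlX hlY hX0 hX1 hY0 hY1 hlt
      have e1 := endIndex_eq_of_returning hΨ hη hlX hX hX0 hX1 hx hs hlt
      have e2 := endIndex_eq_of_returning hΨ hη hlY hY hY0 hY1 hy ht hlt'
      linarith
    · have hlt' := im_lt_im_of_path hM hX hY hp.disjoint hp.path' hs' ht' hlX hlY hX0 hX1 hY0 hY1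
        hlt
      have e1 := endIndex_eq_of_returning hΨ hη hlX hX hX0 hX1 hx hs' hlt
      have e2 := endIndex_eq_of_returning hΨ hη hlY hY hY0 hY1 hy ht' hlt'
      linarith
  · have hYn : ‖Y 0‖ ≠ ‖Y 1‖ := by
      intro e
      apply hXn
      rcases hs with ⟨rfl, rfl⟩ | ⟨rfl, rfl⟩ <;> rcases ht with ⟨rfl, rfl⟩ | ⟨rfl, rfl⟩ <;>
        rw [hn, hn', e]
    have e1 := endIndex_eq_of_crossing hΨ hη hM hX hXn hx
    have e2 := endIndex_eq_of_crossing hΨ hη hM hY hYn hy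
    rcases hs with ⟨rfl, rfl⟩ | ⟨rfl, rfl⟩ <;> rcases ht with ⟨rfl, rfl⟩ | ⟨rfl, rfl⟩ <;> linarith

end AnnulusFoliation

theorem mainTheorem8 :
    ∃ c : AnnulusFoliation.FoliationClass,
      (∀ M : Set ℂ, AnnulusFoliation.IsMarking M → ∀ η : AnnulusFoliation.Foliation,
        AnnulusFoliation.IsBalanced M η ↔ AnnulusFoliation.Foliation.toClass η = c) ∧
      (∀ η : AnnulusFoliation.Foliation,
        AnnulusFoliation.WindsTrivially η ↔ AnnulusFoliation.Foliation.toClass η = c) ∧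
      (∀ η : AnnulusFoliation.Foliation,
        AnnulusFoliation.HasDegree (AnnulusFoliation.Foliation.circleMap η) 0 ↔
          AnnulusFoliation.Foliation.toClass η = c) := by
  refine ⟨AnnulusFoliation.circleFoliation.toClass, fun M hM η => ?_, fun η => ?_, fun η => ?_⟩ <;>
    obtain ⟨ψ, d, h⟩ := AnnulusFoliation.exists_isAngle η <;> rw [h.toClass_eq_iff]
  · exact ⟨h.eq_zero_of_isBalanced hM, by rintro rfl; exact h.isBalanced hM⟩
  · exact ⟨h.eq_zero_of_windsTrivially, by rintro rfl; exact h.windsTrivially⟩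
  · exact ⟨h.hasDegree.unique, by rintro rfl; exact h.hasDegree⟩
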